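/- A Steiner quadruple system $\mathrm{SQS}(n)$ is a pair $(X,\mathcal B)$ where $X$ is a set of $n$ points and $\mathcal B$ is a collection of 4-element subsets (blocks) of $X$ such that any three points of $X$ lie in a unique block. It admits a 1-ocycle if its blocks can be arranged in a nonempty cyclic list, each block occurring exactly once and written as a string of its four points, so that the last letter of each string is the first letter of the next. Theorem. Let $(X,\mathcal B)$ be an $\mathrm{SQS}(n)$ that admits a 1-ocycle. Then there exists an $\mathrm{SQS}(12n-10)$ that admits a 1-ocycle. Moreover, Hanani's sixth construction, described below, applied to $(X,\mathcal B)$ gives such a system, whatever choices are made in it. The construction. Let $\mathcal B(14)$ be the set of the following 91 blocks on the points $0,1,\dots,9,A,B,C,D$: 2043, 3162, 25D3, 37A2, 28C3, 3560, 07C3, 38D0, 09A3, 39B2, 2680, 0792, 2AD0, 0BC2, 28B1, 1250, 03B1, 1460, 0781, 19D0, 0AC1, 19A2, 2CD1, 17D3, 38A1, 139C, C841, 19B4, 4095, 5134, 4265, 57A4, 48D5, 57D0, 08C5, 5BC4, 4783, 3D49, 9573, 38B5, 5AC3, 36AD, DBC3, 36C4, 48B6, 60A7, 7196, 62C7, 73B6,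 64D7, 7586, 69C0, 0BD6, 6BC1, 18D6, 629D, DB51, 17C5, 51A6, 69B5, 5C6D, D59A, A26B, B34A, A8DB, B9CA, A05B, B79D, DA7C, CD40, 08A4, 4B07, 749C, C2A4, 4B2D, D872, 27B5, 58A2, 259C, CA68, 80B9, 9158, 8249, 9368, 87A9, 9CD8, 87CB, B17A, A964, 4AD1, 1472. Identify these 14 points in any way with $\{0,\dots,11\}\cup\{A0,A1\}$. Choose a point $p\in X$, put $X'=X\setminus\{p\}$, and for each block $\{u,v,w,p\}$ through $p$ choose an order $(u,v,w)$ of its other three points. The new point set is $(X'\times\mathbb Z_{12})\cup\{A0,A1\}$, where $(x,j)$ is written $x_j$, and all second indices are taken modulo 12. The blocks are: (1) for each $x\in X'$, the blocks of $\mathcal B(14)$ with every $j\in\{0,\dots,11\}$ replaced by $x_j$ ($A0$, $A1$ are kept); (2) for each chosen triple $(u,v,w)=(r^0,r^1,r^2)$, with upper indices modulo 3: $\{Ah,r^0_{b_1},r^1_{b_2},r^2_{b_3+3h}\}$ for $h\in\{0,1\}$ and $b_1+b_2+b_3\equiv 0\pmod{12}$; $\{r^i_{b_1+4+i},r^i_{b_1+7+i},r^{i+1}_{b_2},r^{i+2}_{b_3}\}$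 for $i\in\{0,1,2\}$ and $b_1+b_2+b_3\equiv 0\pmod{12}$; and, for $i\in\{0,1,2\}$, $j\in\mathbb Z_{12}$, $\epsilon\in\{0,1\}$, the four blocks $$\{r^i_j,\ r^{i+1}_{j+6\epsilon},\ r^{i+2}_{6\epsilon-2j+1},\ r^{i+2}_{6\epsilon-2j-1}\},\qquad \{r^i_j,\ r^{i+1}_{j+6\epsilon},\ r^{i+2}_{6\epsilon-2j+2},\ r^{i+2}_{6\epsilon-2j-2}\},$$ $$\{r^i_j,\ r^{i+1}_{j+6\epsilon-3},\ r^{i+2}_{6\epsilon-2j+1},\ r^{i+2}_{6\epsilon-2j+2}\},\qquad \{r^i_j,\ r^{i+1}_{j+6\epsilon+3},\ r^{i+2}_{6\epsilon-2j-1},\ r^{i+2}_{6\epsilon-2j-2}\};$$ (3) for all ordered pairs $u\neq v$ in $X'$: $\{u_j,u_{j+6},v_{j+3\epsilon},v_{j+6+3\epsilon}\}$ for $j\in\mathbb Z_{12}$, $\epsilon\in\{0,1\}$; $\{u_{2g+3\epsilon},u_{2g+6+3\epsilon},v_{2g+1},v_{2g+5}\}$ and $\{u_{2g+3\epsilon},u_{2g+6+3\epsilon},v_{2g+2},v_{2g+4}\}$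 for $g\in\{0,\dots,5\}$, $\epsilon\in\{0,1\}$; $\{u_j,u_{j+d},v_{j+3e},v_{j+3e+d}\}$ for $d\in\{1,2,4\}$, $j\in\mathbb Z_{12}$, $e\in\{0,1,2,3\}$; and $\{u_r,u_s,v_{r'},v_{s'}\}$ where $\{r,s\}$ and $\{r',s'\}$ both belong to $P_4=\{\{2a,2a+5\}:0\le a\le5\}$ or both belong to $P_5=\{\{2a,2a-5\}:0\le a\le5\}$; (4) $\{x_{a_1},y_{a_2},z_{a_3},t_{a_4}\}$ for each block $\{x,y,z,t\}\in\mathcal B$ not containing $p$ and all $a_1+a_2+a_3+a_4\equiv 0\pmod{12}$. -/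

import Mathlib

/-- `(X, 𝓑)` is a Steiner quadruple system of order `n`: `X` has `n` points, the blocks are
4-element subsets of `X`, and any three points lie in a unique block. -/
def IsSQS {X : Type*} [Fintype X] (n : ℕ) (𝓑 : Set (Finset X)) : Prop :=
  Fintype.card X = n ∧ (∀ b ∈ 𝓑, b.card = 4) ∧
    ∀ t : Finset X, t.card = 3 → ∃! b : Finset X, b ∈ 𝓑 ∧ t ⊆ b

/-- The quadruples in `𝓑` admit a 1-overlap cycle: each block is written exactly once, as a string
`w i` of its four points, in a nonempty cyclic list (indexed by `ZMod m`, `m ≠ 0`) in which the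
last letter of every string is the first letter of the next one. -/
def AdmitsOneOcycle {X : Type*} [DecidableEq X] (𝓑 : Set (Finset X)) : Prop :=
  ∃ (m : ℕ) (w : ZMod m → Fin 4 → X), m ≠ 0 ∧
    (∀ i, Function.Injective (w i)) ∧
    Set.BijOn (fun i => Finset.univ.image (w i)) Set.univ 𝓑 ∧
    ∀ i, w i 3 = w (i + 1) 0

namespace Hanani

/-- The explicit system on 14 points, each block written as a string. -/
def words14 : List (List (Fin 14)) :=
  [[2, 0, 4, 3], [3, 1, 6, 2], [2, 5, 13, 3], [3, 7, 10, 2], [2, 8, 12, 3], [3, 5, 6, 0],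
   [0, 7, 12, 3], [3, 8, 13, 0], [0, 9, 10, 3], [3, 9, 11, 2], [2, 6, 8, 0], [0, 7, 9, 2],
   [2, 10, 13, 0], [0, 11, 12, 2], [2, 8, 11, 1], [1, 2, 5, 0], [0, 3, 11, 1], [1, 4, 6, 0],
   [0, 7, 8, 1], [1, 9, 13, 0], [0, 10, 12, 1], [1, 9, 10, 2], [2, 12, 13, 1], [1, 7, 13, 3],
   [3, 8, 10, 1], [1, 3, 9, 12], [12, 8, 4, 1], [1, 9, 11, 4], [4, 0, 9, 5], [5, 1, 3, 4],
   [4, 2, 6, 5], [5, 7, 10, 4], [4, 8, 13, 5], [5, 7, 13, 0], [0, 8, 12, 5], [5, 11, 12, 4],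
   [4, 7, 8, 3], [3, 13, 4, 9], [9, 5, 7, 3], [3, 8, 11, 5], [5, 10, 12, 3], [3, 6, 10, 13],
   [13, 11, 12, 3], [3, 6, 12, 4], [4, 8, 11, 6], [6, 0, 10, 7], [7, 1, 9, 6], [6, 2, 12, 7],
   [7, 3, 11, 6], [6, 4, 13, 7], [7, 5, 8, 6], [6, 9, 12, 0], [0, 11, 13, 6], [6, 11, 12, 1],
   [1, 8, 13, 6], [6, 2, 9, 13], [13, 11, 5, 1], [1, 7, 12, 5], [5, 1, 10, 6], [6, 9, 11, 5],
   [5, 12, 6, 13], [13, 5, 9, 10], [10, 2, 6, 11], [11, 3, 4, 10], [10, 8, 13, 11], [11, 9, 12, 10],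
   [10, 0, 5, 11], [11, 7, 9, 13], [13, 10, 7, 12], [12, 13, 4, 0], [0, 8, 10, 4], [4, 11, 0, 7],
   [7, 4, 9, 12], [12, 2, 10, 4], [4, 11, 2, 13], [13, 8, 7, 2], [2, 7, 11, 5], [5, 8, 10, 2],
   [2, 5, 9, 12], [12, 10, 6, 8], [8, 0, 11, 9], [9, 1, 5, 8], [8, 2, 4, 9], [9, 3, 6, 8],
   [8, 7, 10, 9], [9, 12, 13, 8], [8, 7, 12, 11], [11, 1, 7, 10], [10, 9, 6, 4], [4, 10, 13, 1],
   [1, 4, 7, 2]]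

/-- The blocks of the explicit SQS(14). -/
def blocks14 : Set (Finset (Fin 14)) := {b | ∃ w ∈ words14, b = w.toFinset}

/-- The points `(row, j)` with `j` modulo 12, together with the two points `A0`, `A1`. -/
abbrev Pt (α : Type*) := (α × ZMod 12) ⊕ Fin 2

/-- The point with first index `u` and second index `j`. -/
abbrev pt {α : Type*} (u : α) (j : ZMod 12) : Pt α := Sum.inl (u, j)

/-- The point `Ah`. -/
abbrev ptA {α : Type*} (h : Fin 2) : Pt α := Sum.inr h

/-- The pairs of `P₄(6)` (for `δ = 0`) and of `P₅(6)` (for `δ = 1`): these are the one-factors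
`{[2a, 2a + 5]}` and `{[2a, 2a - 5]}` of the integers modulo 12. -/
def pairP (δ : Fin 2) (a : Fin 6) : ZMod 12 × ZMod 12 :=
  (2 * (a : ℕ), if δ = 0 then 2 * (a : ℕ) + 5 else 2 * (a : ℕ) - 5)

variable {α : Type*} [DecidableEq α]

/-- The blocks of types (2) to (7) of the SQS(38), with its rows `0, 1, 2` (taken modulo 3)
replaced by `r 0, r 1, r 2`. -/
inductive TripleBlock (r : Fin 3 → α) : Finset (Pt α) → Prop
  | type2 (h : Fin 2) (b₁ b₂ b₃ : ZMod 12) (hb : b₁ + b₂ + b₃ = 0) :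
      TripleBlock r {ptA h, pt (r 0) b₁, pt (r 1) b₂, pt (r 2) (b₃ + 3 * (h : ℕ))}
  | type3 (i : Fin 3) (b₁ b₂ b₃ : ZMod 12) (hb : b₁ + b₂ + b₃ = 0) :
      TripleBlock r {pt (r i) (b₁ + 4 + (i : ℕ)), pt (r i) (b₁ + 7 + (i : ℕ)),
        pt (r (i + 1)) b₂, pt (r (i + 2)) b₃}
  | type4 (i : Fin 3) (j : ZMod 12) (ε : Fin 2) :
      TripleBlock r {pt (r i) j, pt (r (i + 1)) (j + 6 * (ε : ℕ)),
        pt (r (i + 2)) (6 * (ε : ℕ) - 2 * j + 1), pt (r (i + 2)) (6 * (ε : ℕ) - 2 * j - 1)}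
  | type5 (i : Fin 3) (j : ZMod 12) (ε : Fin 2) :
      TripleBlock r {pt (r i) j, pt (r (i + 1)) (j + 6 * (ε : ℕ)),
        pt (r (i + 2)) (6 * (ε : ℕ) - 2 * j + 2), pt (r (i + 2)) (6 * (ε : ℕ) - 2 * j - 2)}
  | type6 (i : Fin 3) (j : ZMod 12) (ε : Fin 2) :
      TripleBlock r {pt (r i) j, pt (r (i + 1)) (j + 6 * (ε : ℕ) - 3),
        pt (r (i + 2)) (6 * (ε : ℕ) - 2 * j + 1), pt (r (i + 2)) (6 * (ε : ℕ) - 2 * j + 2)}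
  | type7 (i : Fin 3) (j : ZMod 12) (ε : Fin 2) :
      TripleBlock r {pt (r i) j, pt (r (i + 1)) (j + 6 * (ε : ℕ) + 3),
        pt (r (i + 2)) (6 * (ε : ℕ) - 2 * j - 1), pt (r (i + 2)) (6 * (ε : ℕ) - 2 * j - 2)}

/-- The blocks of types (8) to (14) of the SQS(38), with its two rows replaced by `u` and `v`. -/
inductive PairBlock (u v : α) : Finset (Pt α) → Prop
  | type8 (j : ZMod 12) (ε : Fin 2) :
      PairBlock u v {pt u j, pt u (j + 6), pt v (j + 3 * (ε : ℕ)), pt v (j + 6 + 3 * (ε : ℕ))}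
  | type9 (g : Fin 6) (ε : Fin 2) :
      PairBlock u v {pt u (2 * (g : ℕ) + 3 * (ε : ℕ)), pt u (2 * (g : ℕ) + 6 + 3 * (ε : ℕ)),
        pt v (2 * (g : ℕ) + 1), pt v (2 * (g : ℕ) + 5)}
  | type10 (g : Fin 6) (ε : Fin 2) :
      PairBlock u v {pt u (2 * (g : ℕ) + 3 * (ε : ℕ)), pt u (2 * (g : ℕ) + 6 + 3 * (ε : ℕ)),
        pt v (2 * (g : ℕ) + 2), pt v (2 * (g : ℕ) + 4)}
  | type11 (j : ZMod 12) (e : Fin 4) :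
      PairBlock u v {pt u j, pt u (j + 1), pt v (j + 3 * (e : ℕ)), pt v (j + 3 * (e : ℕ) + 1)}
  | type12 (j : ZMod 12) (e : Fin 4) :
      PairBlock u v {pt u j, pt u (j + 2), pt v (j + 3 * (e : ℕ)), pt v (j + 3 * (e : ℕ) + 2)}
  | type13 (j : ZMod 12) (e : Fin 4) :
      PairBlock u v {pt u j, pt u (j + 4), pt v (j + 3 * (e : ℕ)), pt v (j + 3 * (e : ℕ) + 4)}
  | type14 (δ : Fin 2) (a a' : Fin 6) :
      PairBlock u v {pt u (pairP δ a).1, pt u (pairP δ a).2,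
        pt v (pairP δ a').1, pt v (pairP δ a').2}

variable {X : Type*} [DecidableEq X]

/-- `T` lists, for every block of `𝓑` through the point `p`, the three other points of this block in
exactly one order `(u, v, w)`. -/
def IsOrdering (𝓑 : Set (Finset X)) (p : X) (T : Set (Fin 3 → {x : X // x ≠ p})) : Prop :=
  Set.BijOn (fun r => insert p (Finset.univ.image fun k => (r k : X))) T {b | b ∈ 𝓑 ∧ p ∈ b}

/-- The blocks of Hanani's sixth construction, from a quadruple system `𝓑` with a distinguished
point `p`, an ordering `T` of the triples `{u, v, w}` with `{u, v, w, p} ∈ 𝓑`, and an identification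
`e` of the 14 points of the SQS(14) with `{0, …, 11} ∪ {A0, A1}`. -/
inductive SixthBlock (𝓑 : Set (Finset X)) (p : X) (T : Set (Fin 3 → {x : X // x ≠ p}))
    (e : Fin 14 ≃ ZMod 12 ⊕ Fin 2) : Finset (Pt {x : X // x ≠ p}) → Prop
  | copy14 (i : {x : X // x ≠ p}) (b : Finset (Fin 14)) (hb : b ∈ blocks14) :
      SixthBlock 𝓑 p T e (b.image fun q => Sum.map (Prod.mk i) id (e q))
  | triple (r : Fin 3 → {x : X // x ≠ p}) (hr : r ∈ T) (b : Finset (Pt {x : X // x ≠ p}))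
      (hb : TripleBlock r b) : SixthBlock 𝓑 p T e b
  | pair (u v : {x : X // x ≠ p}) (huv : u ≠ v) (b : Finset (Pt {x : X // x ≠ p}))
      (hb : PairBlock u v b) : SixthBlock 𝓑 p T e b
  | quad (x y z t : {x : X // x ≠ p}) (hb : ({x.1, y.1, z.1, t.1} : Finset X) ∈ 𝓑)
      (a₁ a₂ a₃ a₄ : ZMod 12) (ha : a₁ + a₂ + a₃ + a₄ = 0) :
      SixthBlock 𝓑 p T e {pt x a₁, pt y a₂, pt z a₃, pt t a₄}

/-- The block set of Hanani's sixth construction. -/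
def sixth (𝓑 : Set (Finset X)) (p : X) (T : Set (Fin 3 → {x : X // x ≠ p}))
    (e : Fin 14 ≃ ZMod 12 ⊕ Fin 2) : Set (Finset (Pt {x : X // x ≠ p})) :=
  {b | SixthBlock 𝓑 p T e b}

end Hanani

/-!
The theorem combines two independent facts.

*Every Steiner quadruple system on at least ten points admits a 1-ocycle*
(`IsSQS.admitsOneOcycle`). Only the first and the last letter of a string matter, so a 1-ocycle is
the same as a choice of an edge (a pair of points) inside every block together with a closed trail
through all chosen edges. By Euler's theorem (`exists_closed_trail`) it is enough that the chosen
edges form a connected multigraph with even degrees. Fix two points `p` and `q`. Hall's theorem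
matches every other point `x` with a block of its own through `p` and `x` that misses `q`
(`IsSQS.exists_matching`); this block gets the edge `p – x`, and the resulting star makes the
multigraph connected whatever edges the other blocks get. The blocks `{p, q, a, a'}` partition the
points other than `p` and `q`, and the edges `p – q`, `p – a`, `p – a'`, `a – a'` realize all four
parities at `a` and `a'`, which repairs the degrees of all points except `p` and `q`. If a block
`{p, q, x, x'}` has to contribute different parities at `x` and `x'`, then `q` may replace `p` as
the other end of its edge, which repairs `p`; the degree of `q` is then even because the sum of all
degrees is. A block through `q` and `x` that misses `p` and `x'` is used to arrange that the two
parities differ (`IsSQS.exists_even_edges`).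

*Hanani's construction yields a Steiner quadruple system* (`Hanani.sixth_isSQS`). Three points of
one row together with `A0`, `A1` lie in a unique copy of a block of the SQS(14). If the points meet
two rows `u ≠ v`, then `{p, u, v}` lies in a unique block of `𝓑`, so there is a unique chosen triple
`r` with the entries `u` and `v`.
If the points lie over `r` and `A0`, `A1`, everything takes place in the three-row system `Model`
on `Fin 3` transported along `r`, and the claim is the finite statement `model_existsUnique`.
Otherwise the three rows lie in a block of `𝓑` that misses `p`, and the fourth point is determined
by the condition that the second indices have sum zero.

The finite statement is reduced to computations with natural numbers, carried out in the kernel. The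
blocks of `Model` are numbered by codes, and `codeOf` computes from three points the code of a block
through them, by explicit formulas in the residues of the second indices. `coverCheck` says that
this block contains the three points. `uniqueCheck` says that for three points of any block the
computed block has the same fourth point. The formulas for `codeOf` need no justification beyond
these two checks.

A system that admits a 1-ocycle has a block, hence `n ≥ 4` and `12 * n - 10 ≥ 10`.
-/

/-! ### Euler circuits in multigraphs -/

section Euler

variable {V ι : Type*}

/-- The starting point of the edge `d.1`, traversed forwards or backwards. -/
def dartSrc (s t : ι → V) (d : ι × Bool) : V := if d.2 then s d.1 else t d.1

/-- The end point of the edge `d.1`, traversed forwards or backwards. -/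
def dartTgt (s t : ι → V) (d : ι × Bool) : V := if d.2 then t d.1 else s d.1

/-- A nonempty trail in the multigraph with edges `s i – t i`: consecutive edges fit together, and
no edge is repeated. -/
def IsTrail (s t : ι → V) (l : List (ι × Bool)) : Prop :=
  l ≠ [] ∧ (l.map Prod.fst).Nodup ∧ l.IsChain fun d d' => dartTgt s t d = dartSrc s t d'

/-- The sum of the indicator vectors of `x` and `y` modulo 2. Summed over the edges of a multigraph,
these vectors give the degrees modulo 2. -/
def edgeVec [DecidableEq V] (x y : V) : V → ZMod 2 := Pi.single x 1 + Pi.single y 1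

theorem edgeVec_comm [DecidableEq V] (x y : V) : edgeVec x y = edgeVec y x := add_comm _ _

theorem edgeVec_apply [DecidableEq V] (x y v : V) :
    edgeVec x y v = (if v = x then 1 else 0) + (if v = y then 1 else 0) := by
  simp [edgeVec, Pi.single_apply]

theorem edgeVec_add_edgeVec [DecidableEq V] (x y z : V) :
    edgeVec x y + edgeVec y z = edgeVec x z := by
  ext v
  have : ∀ a b c : ZMod 2, a + b + (b + c) = a + c := by decide
  rw [Pi.add_apply, edgeVec_apply, edgeVec_apply, edgeVec_apply, this]

theorem exists_dart {s t : ι → V} {i : ι} {v : V} (h : v = s i ∨ v = t i) :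
    ∃ d : ι × Bool, d.1 = i ∧ dartSrc s t d = v := by
  rcases h with rfl | rfl
  · exact ⟨(i, true), rfl, rfl⟩
  · exact ⟨(i, false), rfl, rfl⟩

/-- Along a trail the edge vectors telescope modulo 2. -/
theorem sum_edgeVec_of_isChain [DecidableEq V] {s t : ι → V} (d : ι × Bool) (l : List (ι × Bool))
    (hl : (d :: l).IsChain fun d d' => dartTgt s t d = dartSrc s t d') :
    (((d :: l).map Prod.fst).map fun i => edgeVec (s i) (t i)).sum =
      edgeVec (dartSrc s t d) (dartTgt s t ((d :: l).getLast (by simp))) := by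
  have h1 : ∀ d : ι × Bool, edgeVec (s d.1) (t d.1) = edgeVec (dartSrc s t d) (dartTgt s t d) := by
    rintro ⟨i, _ | _⟩
    · exact edgeVec_comm _ _
    · rfl
  induction l generalizing d with
  | nil => simpa using h1 d
  | cons d' l ih =>
    rw [List.isChain_cons_cons] at hl
    rw [List.map_cons, List.map_cons, List.sum_cons, ih d' hl.2, h1, hl.1, edgeVec_add_edgeVec]
    rfl

/-- **Euler's theorem** for multigraphs: if all degrees are even and all edges lie in one connected
component, there is a closed trail through all edges. Connectedness is expressed by `hconn`: a set
of points that no edge leaves contains the ends of all edges or of none. -/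
theorem exists_closed_trail [Fintype ι] [Nonempty ι] [DecidableEq V] (s t : ι → V)
    (heven : ∑ i, edgeVec (s i) (t i) = 0)
    (hconn : ∀ S : Set V, (∀ i, s i ∈ S ↔ t i ∈ S) → (∃ i, s i ∈ S) → ∀ i, s i ∈ S) :
    ∃ l : List (ι × Bool), IsTrail s t l ∧ (∀ i, i ∈ l.map Prod.fst) ∧
      ∀ x ∈ l.getLast?, ∀ y ∈ l.head?, dartTgt s t x = dartSrc s t y := by
  classical
  -- a longest trail
  have hmax : ∃ l, IsTrail s t l ∧ ∀ l', IsTrail s t l' → l'.length ≤ l.length := by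
    have hbdd : BddAbove {n | ∃ l, IsTrail s t l ∧ l.length = n} := by
      refine ⟨Fintype.card ι, ?_⟩
      rintro _ ⟨l, hl, rfl⟩
      simpa using hl.2.1.length_le_card
    have hne : {n | ∃ l, IsTrail s t l ∧ l.length = n}.Nonempty :=
      ⟨1, [(Classical.arbitrary ι, true)], ⟨by simp, by simp, by simp⟩, rfl⟩
    obtain ⟨l, hl, hlen⟩ := Nat.sSup_mem hne hbdd
    exact ⟨l, hl, fun l' hl' => hlen ▸ le_csSup hbdd ⟨l', hl', rfl⟩⟩
  obtain ⟨l, hl, hlmax⟩ := hmax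
  -- a trail cannot be prolonged
  have hext : ∀ l', IsTrail s t l' → l'.length = l.length → ∀ d : ι × Bool,
      d.1 ∉ l'.map Prod.fst → ¬ ∀ x ∈ l'.getLast?, dartTgt s t x = dartSrc s t d := by
    intro l' hl' hlen d hd hx
    have := hlmax (l' ++ [d]) ⟨by simp, ?_, ?_⟩
    · rw [List.length_append, hlen] at this
      simp at this
    · rw [List.map_append, List.nodup_append]
      refine ⟨hl'.2.1, by simp, ?_⟩
      intro a ha b hb
      simp only [List.map_cons, List.map_nil, List.mem_singleton] at hb
      rintro rfl
      exact hd (hb ▸ ha)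
    · rw [List.isChain_append]
      exact ⟨hl'.2.2, by simp, by simpa using hx⟩
  -- it is closed, by parity at its end point
  have hclosed : ∀ x ∈ l.getLast?, ∀ y ∈ l.head?, dartTgt s t x = dartSrc s t y := by
    obtain ⟨hne, hnd, hch⟩ := id hl
    rcases l with _ | ⟨d, l⟩
    · simp
    intro x hx y hy
    simp only [List.head?_cons, Option.mem_def, Option.some.injEq] at hy
    subst hy
    by_contra hxy
    have hlast : x = (d :: l).getLast (by simp) := by
      rw [List.getLast?_eq_getLast_of_ne_nil (by simp)] at hx
      simpa using hx.symm
    have hsum := congrFun (sum_edgeVec_of_isChain d l hch) (dartTgt s t x)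
    rw [← List.sum_toFinset _ hnd, ← hlast, Finset.sum_apply, edgeVec_apply, if_neg hxy,
      if_pos rfl] at hsum
    have : ∃ i ∉ ((d :: l).map Prod.fst).toFinset,
        edgeVec (s i) (t i) (dartTgt s t x) ≠ 0 := by
      by_contra! hno
      have h0 : ∑ i, edgeVec (s i) (t i) (dartTgt s t x) = 0 := by
        rw [← Finset.sum_apply, heven]; rfl
      rw [← Finset.sum_subset (Finset.subset_univ ((d :: l).map Prod.fst).toFinset)
        fun i _ hi => hno i hi, hsum] at h0
      exact absurd h0 (by decide)
    obtain ⟨i, hi, hiv⟩ := this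
    have hv : dartTgt s t x = s i ∨ dartTgt s t x = t i := by
      by_contra! h
      exact hiv (by rw [edgeVec_apply, if_neg h.1, if_neg h.2, add_zero])
    obtain ⟨d', rfl, hd'⟩ := exists_dart hv
    refine hext _ hl rfl d' (by simpa using hi) ?_
    intro z hz
    rw [hd', Option.mem_unique hz hx]
  refine ⟨l, hl, ?_, hclosed⟩
  -- an unused edge at a visited point could be appended after rotating the trail
  have hrot : ∀ d ∈ l, ∀ d' : ι × Bool, dartSrc s t d' = dartSrc s t d →
      d'.1 ∈ l.map Prod.fst := by
    intro d hd d' hdd'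
    by_contra hd'
    obtain ⟨l₁, l₂, rfl⟩ := List.append_of_mem hd
    have hch := List.isChain_append.1 hl.2.2
    refine hext (d :: l₂ ++ l₁) ⟨by simp, ?_, ?_⟩ (by simp; omega) d' ?_ ?_
    · exact ((List.perm_append_comm.map Prod.fst).nodup_iff).1 hl.2.1
    · rw [List.isChain_append]
      refine ⟨hch.2.1, hch.1, ?_⟩
      intro x hx y hy
      refine hclosed x ?_ y ?_
      · rw [List.getLast?_append_of_ne_nil _ (by simp)]; exact hx
      · rw [List.head?_append_of_ne_nil _ (by rintro rfl; simp at hy)]; exact hy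
    · intro h; exact hd' (((List.perm_append_comm.map Prod.fst).mem_iff).1 h)
    · intro x hx
      rw [hdd']
      rcases List.eq_nil_or_concat l₁ with rfl | ⟨l₃, z, rfl⟩
      · exact hclosed x (by simpa using hx) d (by simp)
      · rw [List.concat_eq_append, ← List.append_assoc, List.getLast?_concat, Option.mem_def,
          Option.some.injEq] at hx
        subst hx
        exact hch.2.2 z (by simp) d (by simp)
  have htgt : ∀ d ∈ l, ∃ d' ∈ l, dartSrc s t d' = dartTgt s t d := by
    intro d hd
    obtain ⟨l₁, l₂, rfl⟩ := List.append_of_mem hd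
    rcases l₂ with _ | ⟨d', l₂⟩
    · have hy : ∃ y, y ∈ (l₁ ++ [d]).head? := by
        rcases l₁ with _ | ⟨y, l₁⟩ <;> simp
      obtain ⟨y, hy⟩ := hy
      exact ⟨y, List.mem_of_mem_head? hy, (hclosed d (by simp) y hy).symm⟩
    · have := (List.isChain_append.1 hl.2.2).2.1
      rw [List.isChain_cons_cons] at this
      exact ⟨d', by simp, this.1.symm⟩
  set S : Set V := {v | ∃ d ∈ l, dartSrc s t d = v} with hS
  have hused : ∀ i v, (v = s i ∨ v = t i) → v ∈ S → i ∈ l.map Prod.fst := by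
    rintro i v hv ⟨d, hd, hdv⟩
    obtain ⟨d', rfl, hd'⟩ := exists_dart hv
    exact hrot d hd d' (hd'.trans hdv.symm)
  have hends : ∀ i ∈ l.map Prod.fst, s i ∈ S ∧ t i ∈ S := by
    intro i hi
    obtain ⟨⟨i, o⟩, hd, rfl⟩ := List.mem_map.1 hi
    have h1 : dartSrc s t (i, o) ∈ S := ⟨_, hd, rfl⟩
    have h2 : dartTgt s t (i, o) ∈ S := htgt _ hd
    cases o
    · exact ⟨h2, h1⟩
    · exact ⟨h1, h2⟩
  intro i
  refine hused i (s i) (Or.inl rfl) (hconn S ?_ ?_ i)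
  · intro i
    exact ⟨fun h => (hends i (hused i _ (Or.inl rfl) h)).2,
      fun h => (hends i (hused i _ (Or.inr rfl) h)).1⟩
  · obtain ⟨d, hd⟩ := List.exists_mem_of_ne_nil l hl.1
    exact ⟨d.1, (hends d.1 (List.mem_map_of_mem hd)).1⟩

end Euler

/-! ### One-overlap cycles from edges in the blocks -/

section Ocycle

variable {X : Type*} [DecidableEq X]

/-- A block can be written as a string with prescribed distinct first and last letters. -/
theorem exists_string {b : Finset X} (hb : b.card = 4) {x y : X} (hx : x ∈ b) (hy : y ∈ b)
    (hxy : x ≠ y) : ∃ w : Fin 4 → X, Function.Injective w ∧ Finset.univ.image w = b ∧ w 0 = x ∧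
      w 3 = y := by
  have h2 : (b \ {x, y}).card = 2 := by
    rw [Finset.card_sdiff_of_subset (by simp [Finset.insert_subset_iff, hx, hy]), hb,
      Finset.card_pair hxy]
  obtain ⟨c, d, hcd, h⟩ := Finset.card_eq_two.1 h2
  have hw : Finset.univ.image ![x, c, d, y] = b := by
    have hsub : {x, y} ⊆ b := by simp [Finset.insert_subset_iff, hx, hy]
    rw [← Finset.union_sdiff_of_subset hsub, h]
    ext z
    simp [Fin.exists_fin_succ]
    tauto
  refine ⟨![x, c, d, y], ?_, hw, rfl, rfl⟩
  rw [← Set.injOn_univ, ← Finset.coe_univ, ← Finset.card_image_iff, hw, hb]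
  rfl

/-- A choice of an edge `s b – t b` in every block `b` yields a 1-ocycle if the chosen edges form a
connected multigraph with even degrees. -/
theorem admitsOneOcycle_of_edges {𝓑 : Set (Finset X)} [Fintype 𝓑] (hne : 𝓑.Nonempty)
    (h4 : ∀ b ∈ 𝓑, b.card = 4) (s t : 𝓑 → X) (hs : ∀ b, s b ∈ b.1) (ht : ∀ b, t b ∈ b.1)
    (hst : ∀ b, s b ≠ t b) (heven : ∑ b, edgeVec (s b) (t b) = 0)
    (hconn : ∀ S : Set X, (∀ b, s b ∈ S ↔ t b ∈ S) → (∃ b, s b ∈ S) → ∀ b, s b ∈ S) :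
    AdmitsOneOcycle 𝓑 := by
  have := hne.to_subtype
  obtain ⟨l, ⟨hl0, hnd, hch⟩, hall, hclosed⟩ := exists_closed_trail s t heven hconn
  have hstr : ∀ d : 𝓑 × Bool, ∃ w : Fin 4 → X, Function.Injective w ∧
      Finset.univ.image w = d.1.1 ∧ w 0 = dartSrc s t d ∧ w 3 = dartTgt s t d := by
    rintro ⟨b, _ | _⟩
    · exact exists_string (h4 b.1 b.2) (ht b) (hs b) (hst b).symm
    · exact exists_string (h4 b.1 b.2) (hs b) (ht b) (hst b)
  choose w hwinj hwim hw0 hw3 using hstr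
  have hm : l.length ≠ 0 := by simpa using hl0
  have : NeZero l.length := ⟨hm⟩
  refine ⟨l.length, fun i => w (l[i.val]'(ZMod.val_lt i)), hm, fun i => hwinj _, ?_, ?_⟩
  · simp only [hwim]
    refine ⟨fun i _ => Subtype.property _, ?_, ?_⟩
    · intro i _ j _ hij
      have h := Subtype.ext hij
      have h' : (l.map Prod.fst)[i.val]'(by simpa using ZMod.val_lt i) =
          (l.map Prod.fst)[j.val]'(by simpa using ZMod.val_lt j) := by simpa using h
      exact ZMod.val_injective _ ((hnd.getElem_inj_iff).1 h')
    · intro b hb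
      obtain ⟨d, hd, hdb⟩ := List.mem_map.1 (hall ⟨b, hb⟩)
      obtain ⟨k, hk, rfl⟩ := List.mem_iff_getElem.1 hd
      refine ⟨(k : ZMod l.length), trivial, ?_⟩
      simp only [ZMod.val_natCast, Nat.mod_eq_of_lt hk, hdb]
  · intro i
    simp only [hw0, hw3]
    have hi := ZMod.val_lt i
    have hval : (i + 1).val = (i.val + 1) % l.length := by
      rw [ZMod.val_add, ZMod.val_one_eq_one_mod, Nat.add_mod_mod]
    rcases Nat.lt_or_ge (i.val + 1) l.length with h | h
    · simp only [hval, Nat.mod_eq_of_lt h]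
      exact List.isChain_iff_getElem.1 hch i.val h
    · have h' : i.val + 1 = l.length := by omega
      simp only [hval, h', Nat.mod_self]
      refine hclosed _ ?_ _ ?_
      · rw [List.getLast?_eq_getElem?, show l.length - 1 = i.val by omega]; simp
      · rw [List.head?_eq_getElem?]; simp

end Ocycle

/-! ### Steiner quadruple systems on at least ten points admit 1-ocycles -/

theorem IsSQS.eq_of_subset {X : Type*} [Fintype X] {n : ℕ} {𝓑 : Set (Finset X)} (hS : IsSQS n 𝓑)
    {t b b' : Finset X} (ht : t.card = 3) (hb : b ∈ 𝓑) (hb' : b' ∈ 𝓑) (htb : t ⊆ b)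
    (htb' : t ⊆ b') : b = b' :=
  (hS.2.2 t ht).unique ⟨hb, htb⟩ ⟨hb', htb'⟩

section SQS

set_option linter.unusedSectionVars false

variable {X : Type*} [Fintype X] [DecidableEq X] {n : ℕ} {𝓑 : Set (Finset X)}

theorem IsSQS.exists_block (hS : IsSQS n 𝓑) {x y z : X} (hxy : x ≠ y) (hxz : x ≠ z)
    (hyz : y ≠ z) : ∃ b ∈ 𝓑, x ∈ b ∧ y ∈ b ∧ z ∈ b := by
  obtain ⟨b, ⟨hb, hsub⟩, -⟩ := hS.2.2 {x, y, z}
    (Finset.card_eq_three.2 ⟨_, _, _, hxy, hxz, hyz, rfl⟩)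
  exact ⟨b, hb, hsub (by simp), hsub (by simp), hsub (by simp)⟩

theorem IsSQS.eq_of_mem (hS : IsSQS n 𝓑) {x y z : X} (hxy : x ≠ y) (hxz : x ≠ z)
    (hyz : y ≠ z) {b b' : Finset X} (hb : b ∈ 𝓑) (hb' : b' ∈ 𝓑) (hx : x ∈ b) (hy : y ∈ b)
    (hz : z ∈ b) (hx' : x ∈ b') (hy' : y ∈ b') (hz' : z ∈ b') : b = b' :=
  hS.eq_of_subset (Finset.card_eq_three.2 ⟨_, _, _, hxy, hxz, hyz, rfl⟩) hb hb'
    (by simp [Finset.insert_subset_iff, *]) (by simp [Finset.insert_subset_iff, *])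

theorem exists_eq_insert_of_card_eq_four {b : Finset X} (hb : b.card = 4) {x y z : X} (hxy : x ≠ y)
    (hxz : x ≠ z) (hyz : y ≠ z) (hx : x ∈ b) (hy : y ∈ b) (hz : z ∈ b) :
    ∃ w, w ≠ x ∧ w ≠ y ∧ w ≠ z ∧ b = {x, y, z, w} := by
  have hsub : {x, y, z} ⊆ b := by simp [Finset.insert_subset_iff, *]
  have h1 : (b \ {x, y, z}).card = 1 := by
    rw [Finset.card_sdiff_of_subset hsub, hb,
      Finset.card_eq_three.2 ⟨_, _, _, hxy, hxz, hyz, rfl⟩]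
  obtain ⟨w, hw⟩ := Finset.card_eq_one.1 h1
  have hwb : w ∈ b \ {x, y, z} := by rw [hw]; simp
  simp only [Finset.mem_sdiff, Finset.mem_insert, Finset.mem_singleton, not_or] at hwb
  refine ⟨w, hwb.2.1, hwb.2.2.1, hwb.2.2.2, ?_⟩
  rw [← Finset.union_sdiff_of_subset hsub, hw]
  ext; simp

/-- Through any two points `p`, `x` there are at least three blocks that miss a third point `q`. -/
theorem IsSQS.three_le_card_blocks (hS : IsSQS n 𝓑) (hn : 10 ≤ n) {p q x : X} (hpq : p ≠ q)
    (hpx : p ≠ x) (hqx : q ≠ x) {t : Finset (Finset X)}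
    (ht : ∀ b, b ∈ t ↔ b ∈ 𝓑 ∧ p ∈ b ∧ x ∈ b ∧ q ∉ b) : 3 ≤ t.card := by
  obtain ⟨M, hM, hpM, hqM, hxM⟩ := hS.exists_block hpq hpx hqx
  have hsub : Finset.univ \ M ⊆ t.biUnion fun b => b \ {p, x} := by
    intro y hy
    simp only [Finset.mem_sdiff, Finset.mem_univ, true_and] at hy
    have hpy : p ≠ y := fun h => hy (h ▸ hpM)
    have hxy : x ≠ y := fun h => hy (h ▸ hxM)
    obtain ⟨b, hb, hpb, hxb, hyb⟩ := hS.exists_block hpx hpy hxy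
    have hqb : q ∉ b := by
      intro hqb
      exact hy (hS.eq_of_mem hpq hpx hqx hb hM hpb hqb hxb hpM hqM hxM ▸ hyb)
    simp only [Finset.mem_biUnion, Finset.mem_sdiff, Finset.mem_insert, Finset.mem_singleton]
    exact ⟨b, (ht b).2 ⟨hb, hpb, hxb, hqb⟩, hyb, by simp [hpy.symm, hxy.symm]⟩
  have h1 := Finset.card_le_card hsub
  have h2 : (t.biUnion fun b => b \ {p, x}).card ≤ t.card * 2 := by
    refine Finset.card_biUnion_le_card_mul _ _ _ fun b hb => ?_
    obtain ⟨hb, hpb, hxb, -⟩ := (ht b).1 hb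
    rw [Finset.card_sdiff_of_subset (by simp [Finset.insert_subset_iff, *]), hS.2.1 b hb,
      Finset.card_pair hpx]
  have h3 : (Finset.univ \ M).card = n - 4 := by
    rw [Finset.card_sdiff_of_subset (Finset.subset_univ M), Finset.card_univ, hS.1, hS.2.1 M hM]
  omega

/-- By Hall's theorem, the points `x` different from `p` and `q` can be matched with distinct
blocks through `p` and `x` that miss `q`. -/
theorem IsSQS.exists_matching (hS : IsSQS n 𝓑) (hn : 10 ≤ n) {p q : X} (hpq : p ≠ q) :
    ∃ f : {x : X // x ≠ p ∧ x ≠ q} → Finset X, Function.Injective f ∧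
      ∀ x, f x ∈ 𝓑 ∧ p ∈ f x ∧ x.1 ∈ f x ∧ q ∉ f x := by
  classical
  set t : {x : X // x ≠ p ∧ x ≠ q} → Finset (Finset X) := fun x =>
    Finset.univ.filter fun b => b ∈ 𝓑 ∧ p ∈ b ∧ x.1 ∈ b ∧ q ∉ b with ht
  have hmem : ∀ x b, b ∈ t x ↔ b ∈ 𝓑 ∧ p ∈ b ∧ x.1 ∈ b ∧ q ∉ b := by simp [ht]
  have hall : ∀ s : Finset {x : X // x ≠ p ∧ x ≠ q}, s.card ≤ (s.biUnion t).card := by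
    intro s
    have h := Finset.card_mul_le_card_mul (s := s) (t := s.biUnion t) (m := 3) (n := 3)
      (fun x b => b ∈ t x) ?_ ?_
    · omega
    · intro x hx
      refine (hS.three_le_card_blocks hn hpq x.2.1.symm x.2.2.symm (hmem x)).trans
        (Finset.card_le_card fun b hb => ?_)
      rw [Finset.mem_bipartiteAbove]
      exact ⟨Finset.mem_biUnion.2 ⟨x, hx, hb⟩, hb⟩
    · intro b hb
      obtain ⟨x, -, hx⟩ := Finset.mem_biUnion.1 hb
      obtain ⟨hb, hpb, -, -⟩ := (hmem x b).1 hx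
      have h3 : (b.erase p).card = 3 := by rw [Finset.card_erase_of_mem hpb, hS.2.1 b hb]
      rw [← h3]
      refine Finset.card_le_card_of_injOn Subtype.val ?_ Subtype.val_injective.injOn
      intro y hy
      have := ((hmem y b).1 ((Finset.mem_bipartiteBelow _).1 hy).2).2.2.1
      exact Finset.mem_coe.2 (Finset.mem_erase.2 ⟨y.2.1, this⟩)
  obtain ⟨f, hf, hft⟩ := (Finset.all_card_le_biUnion_card_iff_exists_injective t).1 hall
  exact ⟨f, hf, fun x => (hmem x _).1 (hft x)⟩

/-- The vector `c` is the edge vector of two points of `b`. -/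
def IsEdgeOf (b : Finset X) (c : X → ZMod 2) : Prop :=
  ∃ x ∈ b, ∃ y ∈ b, x ≠ y ∧ c = edgeVec x y

theorem IsEdgeOf.apply_eq_zero {b : Finset X} {c : X → ZMod 2} (h : IsEdgeOf b c) {v : X}
    (hv : v ∉ b) : c v = 0 := by
  obtain ⟨x, hx, y, hy, -, rfl⟩ := h
  rw [edgeVec_apply, if_neg (by rintro rfl; exact hv hx), if_neg (by rintro rfl; exact hv hy),
    add_zero]

theorem sum_edgeVec (x y : X) : ∑ v, edgeVec x y v = 0 := by
  simp only [edgeVec_apply, Finset.sum_add_distrib, Finset.sum_ite_eq', Finset.mem_univ, if_true]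
  decide

theorem IsEdgeOf.sum_eq_zero {b : Finset X} {c : X → ZMod 2} (h : IsEdgeOf b c) :
    ∑ v, c v = 0 := by
  obtain ⟨x, -, y, -, -, rfl⟩ := h
  exact sum_edgeVec x y

theorem zmod_two_cases : ∀ a : ZMod 2, a = 0 ∨ a = 1 := by decide

/-- The edges in a block `{p, q, a, a'}` realize all parities at `a` and `a'`. -/
theorem exists_isEdgeOf_eq {b : Finset X} (hb : b.card = 4) {p q : X} (hpq : p ≠ q) (hp : p ∈ b)
    (hq : q ∈ b) (d : X → ZMod 2) :
    ∃ c, IsEdgeOf b c ∧ ∀ v ∈ b, v ≠ p → v ≠ q → c v = d v := by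
  have h2 : (b \ {p, q}).card = 2 := by
    rw [Finset.card_sdiff_of_subset (by simp [Finset.insert_subset_iff, hp, hq]), hb,
      Finset.card_pair hpq]
  obtain ⟨x, y, hxy, h⟩ := Finset.card_eq_two.1 h2
  have hx : x ∈ b \ {p, q} := by rw [h]; simp
  have hy : y ∈ b \ {p, q} := by rw [h]; simp
  simp only [Finset.mem_sdiff, Finset.mem_insert, Finset.mem_singleton, not_or] at hx hy
  obtain ⟨hxb, hxp, hxq⟩ := hx
  obtain ⟨hyb, hyp, hyq⟩ := hy
  have key : ∀ c : X → ZMod 2, IsEdgeOf b c → c x = d x → c y = d y →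
      ∃ c, IsEdgeOf b c ∧ ∀ v ∈ b, v ≠ p → v ≠ q → c v = d v := by
    intro c hc h1 h2
    refine ⟨c, hc, fun v hv hvp hvq => ?_⟩
    have : v ∈ b \ {p, q} := by simp [hv, hvp, hvq]
    rw [h, Finset.mem_insert, Finset.mem_singleton] at this
    rcases this with rfl | rfl <;> assumption
  rcases zmod_two_cases (d x) with h1 | h1 <;> rcases zmod_two_cases (d y) with h2 | h2
  · exact key (edgeVec p q) ⟨p, hp, q, hq, hpq, rfl⟩ (by simp [edgeVec_apply, *])
      (by simp [edgeVec_apply, *])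
  · exact key (edgeVec p y) ⟨p, hp, y, hyb, Ne.symm hyp, rfl⟩ (by simp [edgeVec_apply, *])
      (by simp [edgeVec_apply, *])
  · exact key (edgeVec p x) ⟨p, hp, x, hxb, Ne.symm hxp, rfl⟩ (by simp [edgeVec_apply, *])
      (by simp [edgeVec_apply, *, hxy.symm])
  · exact key (edgeVec x y) ⟨x, hxb, y, hyb, hxy, rfl⟩ (by simp [edgeVec_apply, *])
      (by simp [edgeVec_apply, *, hxy.symm])

/-- A vector of even weight on `{p, q, x, x'}` with different values at `x` and `x'` is an edge
vector of this block, since its values at `p` and `q` differ, too. -/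
theorem isEdgeOf_of_apply_ne {p q x x' : X} (hpq : p ≠ q) (hpx : p ≠ x) (hpx' : p ≠ x')
    (hqx : q ≠ x) (hqx' : q ≠ x') (hxx' : x ≠ x') {e : X → ZMod 2}
    (h0 : ∀ v, v ∉ ({p, q, x, x'} : Finset X) → e v = 0) (hsum : ∑ v, e v = 0)
    (hne : e x ≠ e x') : IsEdgeOf {p, q, x, x'} e := by
  rw [← Finset.sum_subset (Finset.subset_univ {p, q, x, x'}) fun v _ hv => h0 v hv,
    Finset.sum_insert (by simp [*]), Finset.sum_insert (by simp [*]),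
    Finset.sum_insert (by simp [*]), Finset.sum_singleton] at hsum
  have key : ∀ u w, u ∈ ({p, q, x, x'} : Finset X) → w ∈ ({p, q, x, x'} : Finset X) → u ≠ w →
      (∀ v ∈ ({p, q, x, x'} : Finset X), e v = edgeVec u w v) → IsEdgeOf {p, q, x, x'} e := by
    intro u w hu hw huw h
    refine ⟨u, hu, w, hw, huw, funext fun v => ?_⟩
    by_cases hv : v ∈ ({p, q, x, x'} : Finset X)
    · exact h v hv
    · rw [h0 v hv, IsEdgeOf.apply_eq_zero ⟨u, hu, w, hw, huw, rfl⟩ hv]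
  have hcases : ∀ a b c d : ZMod 2, a + (b + (c + d)) = 0 → c ≠ d →
      (a = 1 ∧ b = 0 ∧ c = 1 ∧ d = 0) ∨ (a = 1 ∧ b = 0 ∧ c = 0 ∧ d = 1) ∨
      (a = 0 ∧ b = 1 ∧ c = 1 ∧ d = 0) ∨ (a = 0 ∧ b = 1 ∧ c = 0 ∧ d = 1) := by decide
  have sym := And.intro hpq.symm (And.intro hpx.symm (And.intro hpx'.symm
    (And.intro hqx.symm (And.intro hqx'.symm hxx'.symm))))
  rcases hcases _ _ _ _ hsum hne with ⟨h1, h2, h3, h4⟩ | ⟨h1, h2, h3, h4⟩ | ⟨h1, h2, h3, h4⟩ |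
    ⟨h1, h2, h3, h4⟩
  · exact key p x (by simp) (by simp) hpx (by simp [edgeVec_apply, *])
  · exact key p x' (by simp) (by simp) hpx' (by simp [edgeVec_apply, *])
  · exact key q x (by simp) (by simp) hqx (by simp [edgeVec_apply, *])
  · exact key q x' (by simp) (by simp) hqx' (by simp [edgeVec_apply, *])

/-- One edge can be chosen in every block so that all degrees are even and, for every point `x`
other than `p` and `q`, some block contributes the edge `p – x`. -/
theorem IsSQS.exists_even_edges [Fintype 𝓑] (hS : IsSQS n 𝓑) (hn : 10 ≤ n) {p q : X}
    (hpq : p ≠ q) : ∃ c : 𝓑 → X → ZMod 2, (∀ b, IsEdgeOf b.1 (c b)) ∧ ∑ b, c b = 0 ∧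
      ∀ x, x ≠ p → x ≠ q → ∃ b, c b = edgeVec p x := by
  classical
  have hcard : ∀ s : Finset X, s.card < n → ∃ x, x ∉ s := by
    intro s hs
    by_contra! h
    rw [Finset.eq_univ_of_forall h, Finset.card_univ, hS.1] at hs
    omega
  obtain ⟨x, hx⟩ := hcard {p, q} (by rw [Finset.card_pair hpq]; omega)
  simp only [Finset.mem_insert, Finset.mem_singleton, not_or] at hx
  have hpx : p ≠ x := Ne.symm hx.1
  have hqx : q ≠ x := Ne.symm hx.2
  obtain ⟨M, hM, hpM, hqM, hxM⟩ := hS.exists_block hpq hpx hqx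
  obtain ⟨x', hx'p, hx'q, hx'x, hMeq⟩ :=
    exists_eq_insert_of_card_eq_four (hS.2.1 M hM) hpq hpx hqx hpM hqM hxM
  obtain ⟨y, hy⟩ := hcard M (by rw [hS.2.1 M hM]; omega)
  have hpy : p ≠ y := fun h => hy (h ▸ hpM)
  have hqy : q ≠ y := fun h => hy (h ▸ hqM)
  have hxy : x ≠ y := fun h => hy (h ▸ hxM)
  have hx'y : x' ≠ y := fun h => hy (h ▸ by rw [hMeq]; simp)
  -- the block in which two different edges at `q` are available
  obtain ⟨D, hD, hqD, hxD, hyD⟩ := hS.exists_block hqx hqy hxy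
  have hpD : p ∉ D := fun h =>
    hy (hS.eq_of_mem hpq hpx hqx hD hM h hqD hxD hpM hqM hxM ▸ hyD)
  obtain ⟨f, hf, hfb⟩ := hS.exists_matching hn hpq
  -- provisional edges: the star at `p`, and anything elsewhere
  have hc₀ : ∃ c₀ : 𝓑 → X → ZMod 2, (∀ b, IsEdgeOf b.1 (c₀ b)) ∧
      ∀ b x, b.1 = f x → c₀ b = edgeVec p x.1 := by
    have : ∀ b : 𝓑, ∃ c, IsEdgeOf b.1 c ∧ ∀ x, b.1 = f x → c = edgeVec p x.1 := by
      intro b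
      by_cases h : ∃ x, b.1 = f x
      · obtain ⟨x, hbx⟩ := h
        refine ⟨edgeVec p x.1, ⟨p, ?_, x.1, ?_, x.2.1.symm, rfl⟩, ?_⟩
        · rw [hbx]; exact (hfb x).2.1
        · rw [hbx]; exact (hfb x).2.2.1
        · intro y hy; rw [hf (hbx.symm.trans hy)]
      · push Not at h
        have h1 : 1 < b.1.card := by rw [hS.2.1 b.1 b.2]; omega
        obtain ⟨u, hu, v, hv, huv⟩ := Finset.one_lt_card.1 h1
        exact ⟨edgeVec u v, ⟨u, hu, v, hv, huv, rfl⟩, fun x hx => absurd hx (h x)⟩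
    choose c h1 h2 using this
    exact ⟨c, h1, h2⟩
  obtain ⟨c₀, hc₀, hc₀f⟩ := hc₀
  set Q : Finset 𝓑 := Finset.univ.filter fun b => p ∈ b.1 ∧ q ∈ b.1 with hQ
  have memQ : ∀ b, b ∈ Q ↔ p ∈ b.1 ∧ q ∈ b.1 := by simp [hQ]
  set D' : 𝓑 := ⟨D, hD⟩ with hD'
  set M' : 𝓑 := ⟨M, hM⟩ with hM'
  have hDQ : D' ∉ Q := fun h => hpD ((memQ _).1 h).1
  have hMQ : M' ∈ Q := (memQ _).2 ⟨hpM, hqM⟩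
  have hQM : ∀ b, b ∉ Q → b ≠ M' := fun b hb h => hb (h ▸ hMQ)
  -- the edge of `D` makes the degrees at `x` and `x'` differ
  have hcD : ∃ cD, IsEdgeOf D cD ∧
      (∑ b ∈ Qᶜ.erase D', c₀ b + cD) x ≠ (∑ b ∈ Qᶜ.erase D', c₀ b + cD) x' := by
    by_cases h : (∑ b ∈ Qᶜ.erase D', c₀ b) x = (∑ b ∈ Qᶜ.erase D', c₀ b) x'
    · refine ⟨edgeVec q x, ⟨q, hqD, x, hxD, hqx, rfl⟩, ?_⟩
      rw [Pi.add_apply, Pi.add_apply, h]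
      simp [edgeVec_apply, hqx.symm, hx'q, hx'x]
    · refine ⟨edgeVec q y, ⟨q, hqD, y, hyD, hqy, rfl⟩, ?_⟩
      rw [Pi.add_apply, Pi.add_apply]
      simpa [edgeVec_apply, hqx.symm, hx'q, hxy, hx'y] using h
  obtain ⟨cD, hcD, hne⟩ := hcD
  set d := ∑ b ∈ Qᶜ.erase D', c₀ b + cD with hd
  have hcQ : ∀ b : 𝓑, ∃ c, p ∈ b.1 → q ∈ b.1 → IsEdgeOf b.1 c ∧
      ∀ v ∈ b.1, v ≠ p → v ≠ q → c v = d v := by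
    intro b
    by_cases h : p ∈ b.1 ∧ q ∈ b.1
    · obtain ⟨c, hc⟩ := exists_isEdgeOf_eq (hS.2.1 b.1 b.2) hpq h.1 h.2 d
      exact ⟨c, fun _ _ => hc⟩
    · exact ⟨0, fun h1 h2 => absurd ⟨h1, h2⟩ h⟩
  choose cQ hcQ using hcQ
  -- what remains for the block `M`
  set e := d + ∑ b ∈ Q.erase M', cQ b with he
  have hsumv : ∀ v, v ≠ p → v ≠ q → ∀ m : 𝓑, m ∈ Q → v ∈ m.1 → m ≠ M' →
      (∑ b ∈ Q.erase M', cQ b) v = d v := by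
    intro v hvp hvq m hm hvm hmM
    rw [Finset.sum_apply, Finset.sum_eq_single_of_mem m (Finset.mem_erase.2 ⟨hmM, hm⟩)]
    · exact (hcQ m ((memQ m).1 hm).1 ((memQ m).1 hm).2).2 v hvm hvp hvq
    · intro b hb hbm
      have hb' := (memQ b).1 (Finset.mem_of_mem_erase hb)
      have hm' := (memQ m).1 hm
      refine (hcQ b hb'.1 hb'.2).1.apply_eq_zero fun hvb => hbm (Subtype.ext ?_)
      exact hS.eq_of_mem hpq hvp.symm hvq.symm b.2 m.2 hb'.1 hb'.2 hvb hm'.1 hm'.2 hvm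
  have hsumM : ∀ v, v ≠ p → v ≠ q → v ∈ M → (∑ b ∈ Q.erase M', cQ b) v = 0 := by
    intro v hvp hvq hvM
    rw [Finset.sum_apply]
    refine Finset.sum_eq_zero fun b hb => ?_
    have hb' := (memQ b).1 (Finset.mem_of_mem_erase hb)
    refine (hcQ b hb'.1 hb'.2).1.apply_eq_zero fun hvb => Finset.ne_of_mem_erase hb (Subtype.ext ?_)
    exact hS.eq_of_mem hpq hvp.symm hvq.symm b.2 hM hb'.1 hb'.2 hvb hpM hqM hvM
  have heM : IsEdgeOf M e := by
    have h0 : ∀ v, v ∉ M → e v = 0 := by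
      intro v hv
      have hpv : p ≠ v := fun h => hv (h ▸ hpM)
      have hqv : q ≠ v := fun h => hv (h ▸ hqM)
      obtain ⟨m, hm, hpm, hqm, hvm⟩ := hS.exists_block hpq hpv hqv
      rw [he, Pi.add_apply, hsumv v hpv.symm hqv.symm ⟨m, hm⟩ ((memQ _).2 ⟨hpm, hqm⟩) hvm
        (fun h => hv (by rw [← show m = M from congrArg Subtype.val h]; exact hvm))]
      exact CharTwo.add_self_eq_zero _
    have hx'M : x' ∈ M := by rw [hMeq]; simp
    have hsum : ∑ v, e v = 0 := by
      have aux : ∀ s : Finset 𝓑, ∀ c : 𝓑 → X → ZMod 2, (∀ b ∈ s, IsEdgeOf b.1 (c b)) →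
          ∑ v, (∑ b ∈ s, c b) v = 0 := by
        intro s c hc
        simp only [Finset.sum_apply]
        rw [Finset.sum_comm]
        exact Finset.sum_eq_zero fun b hb => (hc b hb).sum_eq_zero
      simp only [he, hd, Pi.add_apply, Finset.sum_add_distrib]
      rw [aux _ _ fun b _ => hc₀ b, hcD.sum_eq_zero, aux, add_zero, add_zero]
      intro b hb
      have hb' := (memQ b).1 (Finset.mem_of_mem_erase hb)
      exact (hcQ b hb'.1 hb'.2).1
    rw [hMeq] at h0 ⊢
    refine isEdgeOf_of_apply_ne hpq hpx hx'p.symm hqx hx'q.symm hx'x.symm h0 hsum ?_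
    rw [he, Pi.add_apply, Pi.add_apply, hsumM x hpx.symm hqx.symm hxM, hsumM x' hx'p hx'q hx'M,
      add_zero, add_zero]
    exact hne
  refine ⟨fun b => if b = M' then e else if b ∈ Q then cQ b else if b = D' then cD else c₀ b,
    ?_, ?_, ?_⟩
  · intro b
    dsimp only
    split_ifs with h1 h2 h3
    · rw [h1]; exact heM
    · exact (hcQ b ((memQ b).1 h2).1 ((memQ b).1 h2).2).1
    · rw [h3]; exact hcD
    · exact hc₀ b
  -- the edge of `M` cancels the sum of all others, by the choice of `e`
  · rw [← Finset.sum_add_sum_compl Q, ← Finset.add_sum_erase Q _ hMQ,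
      ← Finset.add_sum_erase Qᶜ _ (Finset.mem_compl.2 hDQ), if_pos rfl, if_neg, if_neg hDQ,
      if_pos rfl]
    · have h1 : ∑ b ∈ Q.erase M', (if b = M' then e else if b ∈ Q then cQ b else
          if b = D' then cD else c₀ b) = ∑ b ∈ Q.erase M', cQ b :=
        Finset.sum_congr rfl fun b hb => by
          rw [if_neg (Finset.ne_of_mem_erase hb), if_pos (Finset.mem_of_mem_erase hb)]
      have h2 : ∑ b ∈ Qᶜ.erase D', (if b = M' then e else if b ∈ Q then cQ b else
          if b = D' then cD else c₀ b) = ∑ b ∈ Qᶜ.erase D', c₀ b :=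
        Finset.sum_congr rfl fun b hb => by
          have hbQ := Finset.mem_compl.1 (Finset.mem_of_mem_erase hb)
          rw [if_neg (hQM _ hbQ), if_neg hbQ, if_neg (Finset.ne_of_mem_erase hb)]
      rw [h1, h2]
      have h3 : ∀ a : X → ZMod 2, a + a = 0 := fun a => funext fun v =>
        CharTwo.add_self_eq_zero (a v)
      rw [← h3 e]
      nth_rewrite 3 [he]
      rw [hd]
      abel
    · exact hQM _ hDQ
  · intro x hxp hxq
    obtain ⟨hb, hpb, hxb, hqb⟩ := hfb ⟨x, hxp, hxq⟩
    refine ⟨⟨f ⟨x, hxp, hxq⟩, hb⟩, ?_⟩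
    have hbQ : (⟨f ⟨x, hxp, hxq⟩, hb⟩ : 𝓑) ∉ Q := fun h => hqb ((memQ _).1 h).2
    dsimp only
    rw [if_neg (hQM _ hbQ), if_neg hbQ, if_neg]
    · exact hc₀f _ ⟨x, hxp, hxq⟩ rfl
    · intro h
      exact hpD (by rw [← show f ⟨x, hxp, hxq⟩ = D from congrArg Subtype.val h]; exact hpb)

/-- Every Steiner quadruple system on at least ten points admits a 1-ocycle. -/
theorem IsSQS.admitsOneOcycle (hS : IsSQS n 𝓑) (hn : 10 ≤ n) : AdmitsOneOcycle 𝓑 := by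
  classical
  have : Fintype 𝓑 := Fintype.ofFinite 𝓑
  have h1 : 1 < Fintype.card X := by rw [hS.1]; omega
  obtain ⟨p, q, hpq⟩ := Fintype.exists_pair_of_one_lt_card h1
  obtain ⟨c, hc, hsum, hstar⟩ := hS.exists_even_edges hn hpq
  choose s hs t ht hst hcst using hc
  have hx : ∃ x, x ≠ p ∧ x ≠ q := by
    by_contra! h
    have : (Finset.univ : Finset X) ⊆ {p, q} := by
      intro x _
      by_cases hxp : x = p
      · simp [hxp]
      · simp [h x hxp]
    have := Finset.card_le_card this
    rw [Finset.card_univ, hS.1, Finset.card_pair hpq] at this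
    omega
  obtain ⟨x, hxp, hxq⟩ := hx
  obtain ⟨b, -⟩ := hstar x hxp hxq
  refine admitsOneOcycle_of_edges ⟨b.1, b.2⟩ hS.2.1 s t hs ht hst (by simp only [← hcst, hsum]) ?_
  -- the star at `p` connects everything, since every edge has an end point other than `q`
  intro S hS' ⟨b, hb⟩
  have hSx : ∀ x, x ≠ q → (x ∈ S ↔ p ∈ S) := by
    intro x hxq
    by_cases hxp : x = p
    · rw [hxp]
    obtain ⟨b', hb'⟩ := hstar x hxp hxq
    have hmem : ∀ v, (v = s b' ∨ v = t b') → v = p ∨ v = x := by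
      intro v hv
      by_contra! h
      have h0 : c b' v = 0 := by rw [hb', edgeVec_apply, if_neg h.1, if_neg h.2, add_zero]
      rw [hcst, edgeVec_apply] at h0
      rcases hv with rfl | rfl
      · rw [if_pos rfl, if_neg (hst b')] at h0; exact absurd h0 (by decide)
      · rw [if_pos rfl, if_neg (hst b').symm] at h0; exact absurd h0 (by decide)
    have h := hS' b'
    have hne := hst b'
    rcases hmem _ (Or.inl rfl) with h1 | h1 <;> rcases hmem _ (Or.inr rfl) with h2 | h2 <;>
      rw [h1, h2] at h hne
    · exact absurd rfl hne
    · exact h.symm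
    · exact h
    · exact absurd rfl hne
  have hp : p ∈ S := by
    by_cases h : s b = q
    · exact (hSx (t b) (fun h' => hst b (h.trans h'.symm))).1 ((hS' b).1 hb)
    · exact (hSx (s b) h).1 hb
  intro b
  by_cases h : s b = q
  · exact (hS' b).2 ((hSx (t b) (fun h' => hst b (h.trans h'.symm))).2 hp)
  · exact (hSx (s b) h).2 hp

end SQS

namespace Hanani

/-! ### Codes of the blocks of the three-row system -/

/-- The number of the point with row `r` (modulo 3) and second index, or column, `c`
(modulo 12); the points `A0`, `A1` have the numbers 36 and 37. -/
def ptNum (r c : ℕ) : ℕ := 12 * (r % 3) + c % 12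

/-- The numbers of the four points of the block with the code `(ty, u, v, j, k)`. For `ty ≤ 14` the
type `ty` is that of the constructor of `TripleBlock` or `PairBlock`, except that the case `δ = 1`
of type 14 has number 15. The rows are `u` and, for pair blocks, `v` (triple blocks have `v = 0`, and
in type 2 `u` is the index of `Ah`); `j` and `k` are the remaining parameters. Negative coefficients
are replaced by their residues modulo 12, so that no subtraction of natural numbers is needed. -/
def blockNums : ℕ × ℕ × ℕ × ℕ × ℕ → List ℕ
  | (2, u, _, j, k) =>
    [36 + u, ptNum 0 j, ptNum 1 k, ptNum 2 (11 * j + 11 * k + 3 * u)]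
  | (3, u, _, j, k) =>
    [ptNum u (j + 4 + u), ptNum u (j + 7 + u), ptNum (u + 1) k, ptNum (u + 2) (11 * j + 11 * k)]
  | (4, u, _, j, k) =>
    [ptNum u j, ptNum (u + 1) (j + 6 * k), ptNum (u + 2) (6 * k + 10 * j + 1),
      ptNum (u + 2) (6 * k + 10 * j + 11)]
  | (5, u, _, j, k) =>
    [ptNum u j, ptNum (u + 1) (j + 6 * k), ptNum (u + 2) (6 * k + 10 * j + 2),
      ptNum (u + 2) (6 * k + 10 * j + 10)]
  | (6, u, _, j, k) =>
    [ptNum u j, ptNum (u + 1) (j + 6 * k + 9), ptNum (u + 2) (6 * k + 10 * j + 1),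
      ptNum (u + 2) (6 * k + 10 * j + 2)]
  | (7, u, _, j, k) =>
    [ptNum u j, ptNum (u + 1) (j + 6 * k + 3), ptNum (u + 2) (6 * k + 10 * j + 11),
      ptNum (u + 2) (6 * k + 10 * j + 10)]
  | (8, u, v, j, k) =>
    [ptNum u j, ptNum u (j + 6), ptNum v (j + 3 * k), ptNum v (j + 6 + 3 * k)]
  | (9, u, v, j, k) =>
    [ptNum u (2 * j + 3 * k), ptNum u (2 * j + 6 + 3 * k), ptNum v (2 * j + 1), ptNum v (2 * j + 5)]
  | (10, u, v, j, k) =>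
    [ptNum u (2 * j + 3 * k), ptNum u (2 * j + 6 + 3 * k), ptNum v (2 * j + 2), ptNum v (2 * j + 4)]
  | (11, u, v, j, k) =>
    [ptNum u j, ptNum u (j + 1), ptNum v (j + 3 * k), ptNum v (j + 3 * k + 1)]
  | (12, u, v, j, k) =>
    [ptNum u j, ptNum u (j + 2), ptNum v (j + 3 * k), ptNum v (j + 3 * k + 2)]
  | (13, u, v, j, k) =>
    [ptNum u j, ptNum u (j + 4), ptNum v (j + 3 * k), ptNum v (j + 3 * k + 4)]
  | (14, u, v, j, k) =>
    [ptNum u (2 * j), ptNum u (2 * j + 5), ptNum v (2 * k), ptNum v (2 * k + 5)]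
  | (_, u, v, j, k) =>
    [ptNum u (2 * j), ptNum u (2 * j + 7), ptNum v (2 * k), ptNum v (2 * k + 7)]

/-- The last two entries of a code of the given type range over `{0, …, m - 1}` and
`{0, …, n - 1}`, where `(m, n)` is the value. -/
def codeRange : ℕ → ℕ × ℕ
  | 2 => (12, 12)
  | 3 => (12, 12)
  | 4 => (12, 2)
  | 5 => (12, 2)
  | 6 => (12, 2)
  | 7 => (12, 2)
  | 8 => (12, 2)
  | 9 => (6, 2)
  | 10 => (6, 2)
  | 11 => (12, 4)
  | 12 => (12, 4)
  | 13 => (12, 4)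
  | _ => (6, 6)

/-- The second and third entries of the codes of the given type. For type 2 the second entry is the
index `h` of the point `Ah`, in all other cases it is a row. -/
def codeRows : ℕ → List (ℕ × ℕ)
  | 2 => [(0, 0), (1, 0)]
  | 3 => [(0, 0), (1, 0), (2, 0)]
  | 4 => [(0, 0), (1, 0), (2, 0)]
  | 5 => [(0, 0), (1, 0), (2, 0)]
  | 6 => [(0, 0), (1, 0), (2, 0)]
  | 7 => [(0, 0), (1, 0), (2, 0)]
  | _ => [(0, 1), (0, 2), (1, 0), (1, 2), (2, 0), (2, 1)]

/-- Membership in `codes`, as a test that does not search the list. -/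
def validCode : ℕ × ℕ × ℕ × ℕ × ℕ → Bool
  | (ty, u, v, j, k) =>
    Nat.ble 2 ty && Nat.ble ty 15 && (codeRows ty).any (fun q => Nat.beq q.1 u && Nat.beq q.2 v) &&
      Nat.blt j (codeRange ty).1 && Nat.blt k (codeRange ty).2

/-- The code of the block of type `ty`, one of 4, 5, 6, 7, that contains the point of column `b` in
row `k ≠ i` and whose pair of points in row `i` is the one with `c = 6 * ε - 2 * j`. The
point of the block in row `i + 2` has column `j + 6 * ε + s`. -/
def codeHalf (ty i k b c s : ℕ) : ℕ × ℕ × ℕ × ℕ × ℕ :=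
  let u := (i + 1) % 3
  bif Nat.beq k u then (ty, u, 0, b, (c + 2 * b) % 12 / 6) else
    let j := (b + 12 - s) % 12
    let e := (c + 2 * j) % 12 / 6
    (ty, u, 0, (j + 6 * e) % 12, e)

/-- The code of the block through columns `a`, `a + d` of row `i` and column `b` of row `k`,
for `1 ≤ d ≤ 6`. -/
def codeTwo (i k a b d : ℕ) : ℕ × ℕ × ℕ × ℕ × ℕ :=
  let x := (b + 12 - a) % 12
  match d with
  | 3 =>
    let j := (a + 8 - i) % 12
    (3, i, 0, j, bif Nat.beq k ((i + 1) % 3) then b else 11 * (j + b) % 12)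
  | 5 =>
    bif Nat.beq (a % 2) 0 then
      (14, i, k, a / 2, (bif Nat.beq (b % 2) 0 then b else (b + 7) % 12) / 2)
    else (15, i, k, (a + 5) % 12 / 2, (bif Nat.beq (b % 2) 0 then b else (b + 5) % 12) / 2)
  | 6 =>
    bif Nat.beq (x % 3) 0 then (8, i, k, a, x / 3 % 2) else
      let e := bif Nat.beq (a % 2) 0 then a else a + 3
      let g := (bif Nat.blt ((b + 24 - e) % 12) 6 then e else e + 6) % 12 / 2
      (bif Nat.beq (b % 2) 0 then 10 else 9, i, k, g, a % 2)
  -- for `d = 1, 2, 4` the pair blocks cover the `b` congruent to `a` or `a + d` modulo 3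
  | d =>
    let ty := bif Nat.beq d 1 then 11 else bif Nat.beq d 2 then 12 else 13
    bif Nat.beq (x % 3) 0 then (ty, i, k, a, x / 3) else
    bif Nat.beq ((x + 12 - d) % 3) 0 then (ty, i, k, a, (x + 12 - d) % 12 / 3) else
    bif Nat.beq d 2 then
      bif Nat.beq (a % 2) 0 then (10, k, i, (a + 10) % 12 / 2, b % 2)
      else codeHalf 4 i k b (a + 1) 0 else
    bif Nat.beq d 4 then
      bif Nat.beq (a % 2) 0 then codeHalf 5 i k b (a + 2) 0
      else (9, k, i, (a + 11) % 12 / 2, b % 2) else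
    bif Nat.beq (a % 2) 0 then codeHalf 7 i k b (a + 2) 3
    else codeHalf 6 i k b (a + 11) 9

/-- The code of the block through columns `a`, `a'` of row `i` and column `b` of row `k`. -/
def codePair (i k a a' b : ℕ) : ℕ × ℕ × ℕ × ℕ × ℕ :=
  let d := (a' + 12 - a) % 12
  bif Nat.ble d 6 then codeTwo i k a b d else codeTwo i k a' b (12 - d)

/-- The code of the block through columns `a`, `b`, `c` of rows `i`, `i + 1`, `i + 2`, where
`a` and `b` are congruent modulo 3 and `a + b + c` is 1, 2, 10 or 11. -/
def codeSkew (a b c i : ℕ) : ℕ × ℕ × ℕ × ℕ × ℕ :=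
  let s := (a + b + c) % 12
  let d := (b + 12 - a) % 12
  bif Nat.beq (d % 6) 0 then (bif Nat.beq s 1 || Nat.beq s 11 then 4 else 5, i, 0, a, d / 6) else
  bif Nat.ble 10 s then (6, i, 0, a, (d + 3) / 6 % 2) else (7, i, 0, a, (d + 9) / 6 % 2)

/-- The code of the block through columns `a`, `b`, `c` of rows `0`, `1`, `2`. -/
def codeTransversal (a b c : ℕ) : ℕ × ℕ × ℕ × ℕ × ℕ :=
  match (a + b + c) % 12 with
  | 0 => (2, 0, 0, a, b)
  | 3 => (2, 1, 0, a, b)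
  | 4 => (3, 0, 0, 11 * (b + c) % 12, b)
  | 5 => (3, 1, 0, 11 * (c + a) % 12, c)
  | 6 => (3, 2, 0, 11 * (a + b) % 12, a)
  | 7 => (3, 0, 0, 11 * (b + c) % 12, b)
  | 8 => (3, 1, 0, 11 * (c + a) % 12, c)
  | 9 => (3, 2, 0, 11 * (a + b) % 12, a)
  | _ =>
    bif Nat.beq ((b + 12 - a) % 3) 0 then codeSkew a b c 0 else
    bif Nat.beq ((c + 12 - b) % 3) 0 then codeSkew b c a 1 else codeSkew c a b 2

/-- The code of the block through the points with numbers `x < y < z`. -/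
def codeOf (x y z : ℕ) : ℕ × ℕ × ℕ × ℕ × ℕ :=
  bif Nat.ble 36 z then
    let o := (11 * (x % 12 + y % 12) + 3 * (z - 36)) % 12
    bif Nat.beq (y / 12) 1 then (2, z - 36, 0, x % 12, y % 12) else
    bif Nat.beq (x / 12) 0 then (2, z - 36, 0, x % 12, o) else (2, z - 36, 0, o, x % 12)
  else
  bif Nat.beq (x / 12) (y / 12) then codePair (x / 12) (z / 12) (x % 12) (y % 12) (z % 12) else
  bif Nat.beq (y / 12) (z / 12) then codePair (y / 12) (x / 12) (y % 12) (z % 12) (x % 12) else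
  codeTransversal (x % 12) (y % 12) (z % 12)

/-- The points with numbers `x < y < z` lie in at least two rows. -/
def spread (x y z : ℕ) : Bool :=
  Nat.blt y 36 &&
    (!Nat.beq (x / 12) (y / 12) || (Nat.blt z 36 && !Nat.beq (y / 12) (z / 12)))

/-- Whenever `x < y < z` are spread over at least two rows, `codeOf x y z` is the code of a block
that contains the points `x`, `y`, `z`. -/
def coverCheck : Bool :=
  (List.range 38).all fun z => (List.range z).all fun y => (List.range y).all fun x =>
    !spread x y z || (validCode (codeOf x y z) &&
      ([x, y, z].all fun q => (blockNums (codeOf x y z)).any (Nat.beq q)))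

/-- The codes of all blocks. -/
def codes : List (ℕ × ℕ × ℕ × ℕ × ℕ) :=
  (List.range 16).flatMap fun ty => bif Nat.blt ty 2 then [] else
    (codeRows ty).flatMap fun q => (List.range (codeRange ty).1).flatMap fun j =>
      (List.range (codeRange ty).2).map fun k => (ty, q.1, q.2, j, k)

/-- `f` holds for the three numbers in increasing order. -/
def sorted3 (f : ℕ → ℕ → ℕ → Bool) (x y z : ℕ) : Bool :=
  f (min x (min y z)) (x + y + z - min x (min y z) - max x (max y z)) (max x (max y z))

/-- `x < y < z` are numbers of points that are spread over at least two rows, and the numbers of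
the points of the block `codeOf x y z` have sum `s`. -/
def sumCheck (s x y z : ℕ) : Bool :=
  Nat.blt x y && Nat.blt y z && Nat.blt z 38 && spread x y z &&
    Nat.beq (blockNums (codeOf x y z)).sum s

/-- Any three points of a block are spread over at least two rows, and `codeOf` sends them to a
block with the same fourth point. -/
def uniqueCheck : Bool :=
  codes.all fun q =>
    match blockNums q with
    | [a, b, c, d] =>
      let s := a + b + c + d
      sorted3 (sumCheck s) a b c && sorted3 (sumCheck s) a b d && sorted3 (sumCheck s) a c d &&
        sorted3 (sumCheck s) b c d
    | _ => false

theorem coverCheck_eq : coverCheck = true := by decide +kernel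

theorem uniqueCheck_eq : uniqueCheck = true := by decide +kernel

/-! ### The blocks belonging to the codes -/

/-- The point with a given number. -/
def ofNum (x : ℕ) : Pt (Fin 3) :=
  if x < 36 then pt (Fin.ofNat 3 (x / 12)) ((x % 12 : ℕ) : ZMod 12) else ptA (Fin.ofNat 2 (x - 36))

/-- The number of a point, inverse to `ofNum` on the numbers below 38. -/
def toNum : Pt (Fin 3) → ℕ
  | Sum.inl q => 12 * q.1.val + q.2.val
  | Sum.inr h => 36 + h.val

theorem toNum_lt (q : Pt (Fin 3)) : toNum q < 38 := by
  rcases q with ⟨r, c⟩ | h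
  · have h1 := r.isLt
    have h2 := ZMod.val_lt c
    simp only [toNum]; omega
  · have := h.isLt
    simp only [toNum]; omega

theorem ofNum_toNum (q : Pt (Fin 3)) : ofNum (toNum q) = q := by
  rcases q with ⟨r, c⟩ | h
  · have h1 := r.isLt
    have h2 := ZMod.val_lt c
    have e1 : (12 * r.val + c.val) / 12 = r.val := by omega
    have e2 : (12 * r.val + c.val) % 12 = c.val := by omega
    have e3 : 12 * r.val + c.val < 36 := by omega
    simp [toNum, ofNum, e1, e2, e3]
  · simp [toNum, ofNum]

theorem toNum_injective : Function.Injective toNum :=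
  Function.LeftInverse.injective ofNum_toNum

theorem toNum_ofNum {x : ℕ} (hx : x < 38) : toNum (ofNum x) = x := by
  interval_cases x <;> rfl

theorem ofNum_ptNum (r c : ℕ) : ofNum (ptNum r c) = pt (Fin.ofNat 3 r) (c : ZMod 12) := by
  have h1 : (12 * (r % 3) + c % 12) / 12 = r % 3 := by omega
  have h2 : (12 * (r % 3) + c % 12) % 12 = c % 12 := by omega
  have h3 : 12 * (r % 3) + c % 12 < 36 := by omega
  have h4 : Fin.ofNat 3 (r % 3) = Fin.ofNat 3 r := by
    ext; simp
  rw [ptNum, ofNum, if_pos h3, h1, h2, h4, ZMod.natCast_mod]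

theorem ofNum_ptNum_val (i : Fin 3) (c : ℕ) : ofNum (ptNum i c) = pt i (c : ZMod 12) := by
  rw [ofNum_ptNum, Fin.ofNat_eq_cast, Fin.cast_val_eq_self]

theorem ofNum_ptNum_val_add_one (i : Fin 3) (c : ℕ) :
    ofNum (ptNum (i + 1) c) = pt (i + 1) (c : ZMod 12) := by
  rw [ofNum_ptNum]; congr

theorem ofNum_ptNum_val_add_two (i : Fin 3) (c : ℕ) :
    ofNum (ptNum (i + 2) c) = pt (i + 2) (c : ZMod 12) := by
  rw [ofNum_ptNum]; congr

theorem ofNum_add_36 (u : Fin 2) : ofNum (36 + u) = ptA u := by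
  simp [ofNum]

theorem ten_eq : (10 : ZMod 12) = -2 := rfl
theorem eleven_eq : (11 : ZMod 12) = -1 := rfl
theorem nine_eq : (9 : ZMod 12) = -3 := rfl
theorem seven_eq : (7 : ZMod 12) = -5 := rfl

/-- The block with a given code. -/
def blockOf (q : ℕ × ℕ × ℕ × ℕ × ℕ) : Finset (Pt (Fin 3)) := ((blockNums q).map ofNum).toFinset

theorem blockOf_type2 (h : Fin 2) (b₁ b₂ b₃ : ZMod 12) (hb : b₁ + b₂ + b₃ = 0) :
    blockOf (2, h, 0, b₁.val, b₂.val) =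
      {ptA h, pt 0 b₁, pt 1 b₂, pt 2 (b₃ + 3 * (h : ℕ))} := by
  obtain rfl : b₃ = -b₁ - b₂ := by linear_combination hb
  simp [blockOf, blockNums, ofNum_ptNum, ofNum_add_36, eleven_eq, sub_eq_add_neg]
  rfl

theorem blockOf_type3 (i : Fin 3) (b₁ b₂ b₃ : ZMod 12) (hb : b₁ + b₂ + b₃ = 0) :
    blockOf (3, i, 0, b₁.val, b₂.val) =
      {pt i (b₁ + 4 + (i : ℕ)), pt i (b₁ + 7 + (i : ℕ)), pt (i + 1) b₂, pt (i + 2) b₃} := by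
  obtain rfl : b₃ = -b₁ - b₂ := by linear_combination hb
  simp [blockOf, blockNums, ofNum_ptNum_val, ofNum_ptNum_val_add_one, ofNum_ptNum_val_add_two,
    eleven_eq, sub_eq_add_neg]

theorem blockOf_type4 (i : Fin 3) (j : ZMod 12) (ε : Fin 2) :
    blockOf (4, i, 0, j.val, ε) = {pt i j, pt (i + 1) (j + 6 * (ε : ℕ)),
        pt (i + 2) (6 * (ε : ℕ) - 2 * j + 1), pt (i + 2) (6 * (ε : ℕ) - 2 * j - 1)} := by
  simp [blockOf, blockNums, ofNum_ptNum_val, ofNum_ptNum_val_add_one, ofNum_ptNum_val_add_two,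
    ten_eq, eleven_eq, sub_eq_add_neg]

theorem blockOf_type5 (i : Fin 3) (j : ZMod 12) (ε : Fin 2) :
    blockOf (5, i, 0, j.val, ε) = {pt i j, pt (i + 1) (j + 6 * (ε : ℕ)),
        pt (i + 2) (6 * (ε : ℕ) - 2 * j + 2), pt (i + 2) (6 * (ε : ℕ) - 2 * j - 2)} := by
  simp [blockOf, blockNums, ofNum_ptNum_val, ofNum_ptNum_val_add_one, ofNum_ptNum_val_add_two,
    ten_eq, sub_eq_add_neg]

theorem blockOf_type6 (i : Fin 3) (j : ZMod 12) (ε : Fin 2) :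
    blockOf (6, i, 0, j.val, ε) = {pt i j, pt (i + 1) (j + 6 * (ε : ℕ) - 3),
        pt (i + 2) (6 * (ε : ℕ) - 2 * j + 1), pt (i + 2) (6 * (ε : ℕ) - 2 * j + 2)} := by
  simp [blockOf, blockNums, ofNum_ptNum_val, ofNum_ptNum_val_add_one, ofNum_ptNum_val_add_two,
    ten_eq, nine_eq, sub_eq_add_neg]

theorem blockOf_type7 (i : Fin 3) (j : ZMod 12) (ε : Fin 2) :
    blockOf (7, i, 0, j.val, ε) = {pt i j, pt (i + 1) (j + 6 * (ε : ℕ) + 3),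
        pt (i + 2) (6 * (ε : ℕ) - 2 * j - 1), pt (i + 2) (6 * (ε : ℕ) - 2 * j - 2)} := by
  simp [blockOf, blockNums, ofNum_ptNum_val, ofNum_ptNum_val_add_one, ofNum_ptNum_val_add_two,
    ten_eq, eleven_eq, sub_eq_add_neg]

theorem blockOf_type8 (u v : Fin 3) (j : ZMod 12) (ε : Fin 2) :
    blockOf (8, u, v, j.val, ε) =
      {pt u j, pt u (j + 6), pt v (j + 3 * (ε : ℕ)), pt v (j + 6 + 3 * (ε : ℕ))} := by
  simp [blockOf, blockNums, ofNum_ptNum_val]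

theorem blockOf_type9 (u v : Fin 3) (g : Fin 6) (ε : Fin 2) :
    blockOf (9, u, v, g, ε) =
      {pt u (2 * (g : ℕ) + 3 * (ε : ℕ)), pt u (2 * (g : ℕ) + 6 + 3 * (ε : ℕ)),
        pt v (2 * (g : ℕ) + 1), pt v (2 * (g : ℕ) + 5)} := by
  simp [blockOf, blockNums, ofNum_ptNum_val]

theorem blockOf_type10 (u v : Fin 3) (g : Fin 6) (ε : Fin 2) :
    blockOf (10, u, v, g, ε) =
      {pt u (2 * (g : ℕ) + 3 * (ε : ℕ)), pt u (2 * (g : ℕ) + 6 + 3 * (ε : ℕ)),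
        pt v (2 * (g : ℕ) + 2), pt v (2 * (g : ℕ) + 4)} := by
  simp [blockOf, blockNums, ofNum_ptNum_val]

theorem blockOf_type11 (u v : Fin 3) (j : ZMod 12) (e : Fin 4) :
    blockOf (11, u, v, j.val, e) =
      {pt u j, pt u (j + 1), pt v (j + 3 * (e : ℕ)), pt v (j + 3 * (e : ℕ) + 1)} := by
  simp [blockOf, blockNums, ofNum_ptNum_val]

theorem blockOf_type12 (u v : Fin 3) (j : ZMod 12) (e : Fin 4) :
    blockOf (12, u, v, j.val, e) =
      {pt u j, pt u (j + 2), pt v (j + 3 * (e : ℕ)), pt v (j + 3 * (e : ℕ) + 2)} := by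
  simp [blockOf, blockNums, ofNum_ptNum_val]

theorem blockOf_type13 (u v : Fin 3) (j : ZMod 12) (e : Fin 4) :
    blockOf (13, u, v, j.val, e) =
      {pt u j, pt u (j + 4), pt v (j + 3 * (e : ℕ)), pt v (j + 3 * (e : ℕ) + 4)} := by
  simp [blockOf, blockNums, ofNum_ptNum_val]

theorem blockOf_type14 (u v : Fin 3) (a a' : Fin 6) :
    blockOf (14, u, v, a, a') = {pt u (pairP 0 a).1, pt u (pairP 0 a).2,
        pt v (pairP 0 a').1, pt v (pairP 0 a').2} := by
  simp [blockOf, blockNums, ofNum_ptNum_val, pairP]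

theorem blockOf_type15 (u v : Fin 3) (a a' : Fin 6) :
    blockOf (15, u, v, a, a') = {pt u (pairP 1 a).1, pt u (pairP 1 a).2,
        pt v (pairP 1 a').1, pt v (pairP 1 a').2} := by
  simp [blockOf, blockNums, ofNum_ptNum_val, pairP, seven_eq, sub_eq_add_neg]

/-- The blocks of the SQS(38) that are spread over at least two rows. -/
def Model (b : Finset (Pt (Fin 3))) : Prop :=
  TripleBlock id b ∨ ∃ u v : Fin 3, u ≠ v ∧ PairBlock u v b

theorem model_blockOf {q : ℕ × ℕ × ℕ × ℕ × ℕ} (hq : validCode q = true) : Model (blockOf q) := by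
  obtain ⟨ty, u, v, j, k⟩ := q
  simp only [validCode, Bool.and_eq_true, Nat.ble_eq, Nat.blt_eq, List.any_eq_true,
    Nat.beq_eq, Prod.exists] at hq
  obtain ⟨⟨⟨⟨h2, h15⟩, ⟨u', v', hq, hu, hv⟩⟩, hj⟩, hk⟩ := hq
  subst hu hv
  have key : ∀ {b b' : Finset (Pt (Fin 3))}, b = b' → TripleBlock id b' → Model b := by
    rintro b b' rfl h; exact Or.inl h
  have key2 : ∀ {b b' : Finset (Pt (Fin 3))} {u v : Fin 3}, u ≠ v → b = b' → PairBlock u v b' →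
      Model b := by
    rintro b b' u v huv rfl h; exact Or.inr ⟨u, v, huv, h⟩
  rcases lt_or_ge ty 8 with h8 | h8
  · have hv : v' = 0 := by
      interval_cases ty <;> simp [codeRows] at hq <;> omega
    subst hv
    have hu : u' < 3 := by
      interval_cases ty <;> simp [codeRows] at hq <;> omega
    interval_cases ty <;> simp only [codeRange] at hj hk
    · have hu : u' < 2 := by simp [codeRows] at hq; omega
      exact key (blockOf_type2 ⟨u', hu⟩ ⟨j, hj⟩ ⟨k, hk⟩ _ (add_neg_cancel _))
        (.type2 _ _ _ _ (add_neg_cancel _))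
    · exact key (blockOf_type3 ⟨u', hu⟩ ⟨j, hj⟩ ⟨k, hk⟩ _ (add_neg_cancel _))
        (.type3 _ _ _ _ (add_neg_cancel _))
    · exact key (blockOf_type4 ⟨u', hu⟩ ⟨j, hj⟩ ⟨k, hk⟩) (.type4 _ _ _)
    · exact key (blockOf_type5 ⟨u', hu⟩ ⟨j, hj⟩ ⟨k, hk⟩) (.type5 _ _ _)
    · exact key (blockOf_type6 ⟨u', hu⟩ ⟨j, hj⟩ ⟨k, hk⟩) (.type6 _ _ _)
    · exact key (blockOf_type7 ⟨u', hu⟩ ⟨j, hj⟩ ⟨k, hk⟩) (.type7 _ _ _)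
  · have huv : u' < 3 ∧ v' < 3 ∧ u' ≠ v' := by
      interval_cases ty <;> simp [codeRows] at hq <;> omega
    obtain ⟨hu, hv, hne⟩ := huv
    have hne' : (⟨u', hu⟩ : Fin 3) ≠ ⟨v', hv⟩ := by simpa using hne
    interval_cases ty <;> simp only [codeRange] at hj hk
    · exact key2 hne' (blockOf_type8 ⟨u', hu⟩ ⟨v', hv⟩ ⟨j, hj⟩ ⟨k, hk⟩) (.type8 _ _)
    · exact key2 hne' (blockOf_type9 ⟨u', hu⟩ ⟨v', hv⟩ ⟨j, hj⟩ ⟨k, hk⟩) (.type9 _ _)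
    · exact key2 hne' (blockOf_type10 ⟨u', hu⟩ ⟨v', hv⟩ ⟨j, hj⟩ ⟨k, hk⟩) (.type10 _ _)
    · exact key2 hne' (blockOf_type11 ⟨u', hu⟩ ⟨v', hv⟩ ⟨j, hj⟩ ⟨k, hk⟩) (.type11 _ _)
    · exact key2 hne' (blockOf_type12 ⟨u', hu⟩ ⟨v', hv⟩ ⟨j, hj⟩ ⟨k, hk⟩) (.type12 _ _)
    · exact key2 hne' (blockOf_type13 ⟨u', hu⟩ ⟨v', hv⟩ ⟨j, hj⟩ ⟨k, hk⟩) (.type13 _ _)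
    · exact key2 hne' (blockOf_type14 ⟨u', hu⟩ ⟨v', hv⟩ ⟨j, hj⟩ ⟨k, hk⟩) (.type14 0 _ _)
    · exact key2 hne' (blockOf_type15 ⟨u', hu⟩ ⟨v', hv⟩ ⟨j, hj⟩ ⟨k, hk⟩) (.type14 1 _ _)

theorem mem_codes {ty u v j k : ℕ} : (ty, u, v, j, k) ∈ codes ↔
    ty < 16 ∧ 2 ≤ ty ∧ (u, v) ∈ codeRows ty ∧ j < (codeRange ty).1 ∧ k < (codeRange ty).2 := by
  simp only [codes, List.mem_flatMap, List.mem_range, Bool.cond_eq_ite, Nat.blt_eq]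
  constructor
  · rintro ⟨t, ht, h⟩
    split_ifs at h with h2
    · simp at h
    · simp only [List.mem_flatMap, List.mem_range, List.mem_map, Prod.mk.injEq] at h
      obtain ⟨q, hq, j', hj, k', hk, rfl, rfl, rfl, rfl, rfl⟩ := h
      exact ⟨ht, by omega, hq, hj, hk⟩
  · rintro ⟨h1, h2, h3, h4, h5⟩
    refine ⟨ty, h1, ?_⟩
    rw [if_neg (by omega)]
    simp only [List.mem_flatMap, List.mem_range, List.mem_map]
    exact ⟨_, h3, j, h4, k, h5, rfl⟩

theorem Model.exists_code {b : Finset (Pt (Fin 3))} (hb : Model b) :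
    ∃ q ∈ codes, b = blockOf q := by
  have h0 : ∀ i : Fin 3, (i.val, 0) ∈ [(0, 0), (1, 0), (2, 0)] := by decide
  have h1 : ∀ u v : Fin 3, u ≠ v →
      (u.val, v.val) ∈ [(0, 1), (0, 2), (1, 0), (1, 2), (2, 0), (2, 1)] := by decide
  rcases hb with h | ⟨u, v, huv, h⟩
  · cases h with
    | type2 h b₁ b₂ b₃ hb =>
      refine ⟨_, mem_codes.2 ⟨by decide, by decide, ?_, b₁.val_lt, b₂.val_lt⟩,
        (blockOf_type2 h b₁ b₂ b₃ hb).symm⟩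
      revert h; decide
    | type3 i b₁ b₂ b₃ hb =>
      exact ⟨_, mem_codes.2 ⟨by decide, by decide, h0 i, b₁.val_lt, b₂.val_lt⟩,
        (blockOf_type3 i b₁ b₂ b₃ hb).symm⟩
    | type4 i j ε =>
      exact ⟨_, mem_codes.2 ⟨by decide, by decide, h0 i, j.val_lt, ε.isLt⟩,
        (blockOf_type4 i j ε).symm⟩
    | type5 i j ε =>
      exact ⟨_, mem_codes.2 ⟨by decide, by decide, h0 i, j.val_lt, ε.isLt⟩,
        (blockOf_type5 i j ε).symm⟩
    | type6 i j ε =>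
      exact ⟨_, mem_codes.2 ⟨by decide, by decide, h0 i, j.val_lt, ε.isLt⟩,
        (blockOf_type6 i j ε).symm⟩
    | type7 i j ε =>
      exact ⟨_, mem_codes.2 ⟨by decide, by decide, h0 i, j.val_lt, ε.isLt⟩,
        (blockOf_type7 i j ε).symm⟩
  · have h1 := h1 u v huv
    cases h with
    | type8 j ε =>
      exact ⟨_, mem_codes.2 ⟨by decide, by decide, h1, j.val_lt, ε.isLt⟩,
        (blockOf_type8 u v j ε).symm⟩
    | type9 g ε =>
      exact ⟨_, mem_codes.2 ⟨by decide, by decide, h1, g.isLt, ε.isLt⟩,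
        (blockOf_type9 u v g ε).symm⟩
    | type10 g ε =>
      exact ⟨_, mem_codes.2 ⟨by decide, by decide, h1, g.isLt, ε.isLt⟩,
        (blockOf_type10 u v g ε).symm⟩
    | type11 j e =>
      exact ⟨_, mem_codes.2 ⟨by decide, by decide, h1, j.val_lt, e.isLt⟩,
        (blockOf_type11 u v j e).symm⟩
    | type12 j e =>
      exact ⟨_, mem_codes.2 ⟨by decide, by decide, h1, j.val_lt, e.isLt⟩,
        (blockOf_type12 u v j e).symm⟩
    | type13 j e =>
      exact ⟨_, mem_codes.2 ⟨by decide, by decide, h1, j.val_lt, e.isLt⟩,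
        (blockOf_type13 u v j e).symm⟩
    | type14 δ a a' =>
      fin_cases δ
      · exact ⟨_, mem_codes.2 ⟨by decide, by decide, h1, a.isLt, a'.isLt⟩,
          (blockOf_type14 u v a a').symm⟩
      · exact ⟨_, mem_codes.2 ⟨by decide, by decide, h1, a.isLt, a'.isLt⟩,
          (blockOf_type15 u v a a').symm⟩

/-! ### The three-row system -/

theorem exists_lt_lt_of_card_eq_three {s : Finset ℕ} (hs : s.card = 3) :
    ∃ x y z, x < y ∧ y < z ∧ s = {x, y, z} := by
  obtain ⟨x, y, z, hxy, hxz, hyz, rfl⟩ := Finset.card_eq_three.1 hs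
  have key : ∀ x' y' z', x' < y' → y' < z' → ({x, y, z} : Finset ℕ) = {x', y', z'} →
      ∃ x' y' z', x' < y' ∧ y' < z' ∧ ({x, y, z} : Finset ℕ) = {x', y', z'} :=
    fun x' y' z' h1 h2 h3 => ⟨x', y', z', h1, h2, h3⟩
  rcases lt_or_gt_of_ne hxy with h1 | h1 <;> rcases lt_or_gt_of_ne hxz with h2 | h2 <;>
    rcases lt_or_gt_of_ne hyz with h3 | h3
  · exact key x y z h1 h3 rfl
  · exact key x z y h2 h3 (by ext; simp; tauto)
  · omega
  · exact key z x y h2 h1 (by ext; simp; tauto)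
  · exact key y x z h1 h2 (by ext; simp; tauto)
  · omega
  · exact key y z x h3 h2 (by ext; simp; tauto)
  · exact key z y x h3 h1 (by ext; simp; tauto)

theorem exists_ofNum_of_card_eq_three {t : Finset (Pt (Fin 3))} (ht : t.card = 3) :
    ∃ x y z, x < y ∧ y < z ∧ z < 38 ∧ t = {ofNum x, ofNum y, ofNum z} := by
  have hc : (t.image toNum).card = 3 := by rw [Finset.card_image_of_injective _ toNum_injective, ht]
  obtain ⟨x, y, z, hxy, hyz, h⟩ := exists_lt_lt_of_card_eq_three hc
  refine ⟨x, y, z, hxy, hyz, ?_, ?_⟩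
  · have : z ∈ t.image toNum := by rw [h]; simp
    obtain ⟨q, -, rfl⟩ := Finset.mem_image.1 this
    exact toNum_lt q
  · have := congrArg (Finset.image ofNum) h
    rw [Finset.image_image, show ofNum ∘ toNum = id from funext ofNum_toNum,
      Finset.image_id] at this
    simpa [Finset.image_insert] using this

theorem cover_of_spread {x y z : ℕ} (hxy : x < y) (hyz : y < z) (hz : z < 38)
    (h : spread x y z = true) : validCode (codeOf x y z) = true ∧
      x ∈ blockNums (codeOf x y z) ∧ y ∈ blockNums (codeOf x y z) ∧
      z ∈ blockNums (codeOf x y z) := by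
  have hc := coverCheck_eq
  rw [coverCheck, List.all_eq_true] at hc
  have hc := hc z (List.mem_range.2 hz)
  rw [List.all_eq_true] at hc
  have hc := hc y (List.mem_range.2 hyz)
  rw [List.all_eq_true] at hc
  have hc := hc x (List.mem_range.2 hxy)
  simpa [h, Bool.not_true] using hc

theorem sorted3_apply {f : ℕ → ℕ → ℕ → Bool} {a b c x y z : ℕ} (h : sorted3 f a b c = true)
    (hxy : x < y) (hyz : y < z) (hx : x = a ∨ x = b ∨ x = c) (hy : y = a ∨ y = b ∨ y = c)
    (hz : z = a ∨ z = b ∨ z = c) : f x y z = true := by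
  have h1 : min a (min b c) = x := by omega
  have h2 : max a (max b c) = z := by omega
  have h3 : a + b + c - x - z = y := by omega
  rwa [sorted3, h1, h2, h3] at h

theorem sorted3_sumCheck {s a b c : ℕ} (h : sorted3 (sumCheck s) a b c = true) :
    a ≠ b ∧ a ≠ c ∧ b ≠ c ∧ a < 38 ∧ b < 38 ∧ c < 38 := by
  simp only [sorted3, sumCheck, Bool.and_eq_true, Nat.blt_eq] at h
  omega

/-- The content of `uniqueCheck` in terms of the blocks themselves. -/
theorem Model.card_and_sumCheck {b : Finset (Pt (Fin 3))} (hb : Model b) : b.card = 4 ∧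
    ∀ x y z, x < y → y < z → z < 38 → {ofNum x, ofNum y, ofNum z} ⊆ b →
      sumCheck (∑ q ∈ b, toNum q) x y z = true := by
  obtain ⟨q, hq, rfl⟩ := hb.exists_code
  have hc := uniqueCheck_eq
  rw [uniqueCheck, List.all_eq_true] at hc
  have hc := hc q hq
  rw [blockOf]
  split at hc
  case h_2 => simp at hc
  case h_1 a b c d heq =>
    rw [heq]
    simp only [Bool.and_eq_true] at hc
    obtain ⟨⟨⟨h1, h2⟩, h3⟩, h4⟩ := hc
    obtain ⟨hab, hac, hbc, ha, hb, hc⟩ := sorted3_sumCheck h1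
    obtain ⟨-, had, hbd, -, -, hd⟩ := sorted3_sumCheck h2
    obtain ⟨-, -, hcd, -, -, -⟩ := sorted3_sumCheck h3
    have inj : ∀ {m n}, m < 38 → n < 38 → m ≠ n → ofNum m ≠ ofNum n := by
      intro m n hm hn hmn h
      exact hmn (by rw [← toNum_ofNum hm, ← toNum_ofNum hn, h])
    have iab := inj ha hb hab
    have iac := inj ha hc hac
    have iad := inj ha hd had
    have ibc := inj hb hc hbc
    have ibd := inj hb hd hbd
    have icd := inj hc hd hcd
    have hset : ([a, b, c, d].map ofNum).toFinset = {ofNum a, ofNum b, ofNum c, ofNum d} := by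
      simp
    rw [hset]
    have hsum : ∑ q ∈ ({ofNum a, ofNum b, ofNum c, ofNum d} : Finset (Pt (Fin 3))), toNum q =
        a + b + c + d := by
      rw [Finset.sum_insert (by simp [iab, iac, iad]), Finset.sum_insert (by simp [ibc, ibd]),
        Finset.sum_insert (by simp [icd]), Finset.sum_singleton, toNum_ofNum ha, toNum_ofNum hb,
        toNum_ofNum hc, toNum_ofNum hd]
      ring
    rw [hsum]
    refine ⟨by simp [iab, iac, iad, ibc, ibd, icd], ?_⟩
    intro x y z hxy hyz hz hsub
    have mem : ∀ {m}, m < 38 → ofNum m ∈ ({ofNum x, ofNum y, ofNum z} : Finset (Pt (Fin 3))) →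
        m = a ∨ m = b ∨ m = c ∨ m = d := by
      intro m hm h
      have := hsub h
      simp only [Finset.mem_insert, Finset.mem_singleton] at this
      rcases this with h | h | h | h <;> have h := congrArg toNum h <;>
        rw [toNum_ofNum hm, toNum_ofNum (by assumption)] at h <;> simp [h]
    have mx := mem (m := x) (by omega) (by simp)
    have my := mem (m := y) (by omega) (by simp)
    have mz := mem (m := z) hz (by simp)
    -- one of `a`, `b`, `c`, `d` is none of `x`, `y`, `z`
    have : (d ≠ x ∧ d ≠ y ∧ d ≠ z) ∨ (c ≠ x ∧ c ≠ y ∧ c ≠ z) ∨ (b ≠ x ∧ b ≠ y ∧ b ≠ z) ∨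
      (a ≠ x ∧ a ≠ y ∧ a ≠ z) := by omega
    rcases this with h | h | h | h
    · exact sorted3_apply h1 hxy hyz (by omega) (by omega) (by omega)
    · exact sorted3_apply h2 hxy hyz (by omega) (by omega) (by omega)
    · exact sorted3_apply h3 hxy hyz (by omega) (by omega) (by omega)
    · exact sorted3_apply h4 hxy hyz (by omega) (by omega) (by omega)

theorem Model.card {b : Finset (Pt (Fin 3))} (hb : Model b) : b.card = 4 := hb.card_and_sumCheck.1

/-- The points of `t` meet at least two rows, that is, they do not all lie in one row together with
`A0`, `A1`. -/
def TwoRows {α : Type*} (t : Finset (Pt α)) : Prop :=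
  ∃ (u v : α) (a b : ZMod 12), u ≠ v ∧ pt u a ∈ t ∧ pt v b ∈ t

theorem twoRows_iff_spread {x y z : ℕ} (hxy : x < y) (hyz : y < z) (hz : z < 38) :
    TwoRows ({ofNum x, ofNum y, ofNum z} : Finset (Pt (Fin 3))) ↔ spread x y z = true := by
  have hs : spread x y z = true ↔ y < 36 ∧ (x / 12 ≠ y / 12 ∨ z < 36 ∧ y / 12 ≠ z / 12) := by
    have hne : ∀ m n : ℕ, Nat.beq m n = false ↔ m ≠ n := fun m n => by
      rw [Ne, ← Nat.beq_eq, Bool.not_eq_true]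
    simp [spread, hne]
  rw [hs]
  have row : ∀ {m n}, m < 36 → n < 36 → m / 12 ≠ n / 12 → Fin.ofNat 3 (m / 12) ≠
      Fin.ofNat 3 (n / 12) := by
    intro m n hm hn h h'
    have := congrArg Fin.val h'
    simp at this; omega
  have val : ∀ {m}, m < 36 → ofNum m = pt (Fin.ofNat 3 (m / 12)) ((m % 12 : ℕ) : ZMod 12) := by
    intro m hm; rw [ofNum, if_pos hm]
  constructor
  · rintro ⟨u, v, a, b, huv, hu, hv⟩
    have mem : ∀ (i : Fin 3) (c : ZMod 12), pt i c ∈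
        ({ofNum x, ofNum y, ofNum z} : Finset (Pt (Fin 3))) →
        12 * i.val + c.val = x ∨ 12 * i.val + c.val = y ∨ 12 * i.val + c.val = z := by
      intro i c h
      simp only [Finset.mem_insert, Finset.mem_singleton] at h
      rcases h with h | h | h <;> have h := congrArg toNum h <;>
        rw [toNum_ofNum (by omega)] at h <;> simp only [toNum] at h <;> simp [h]
    have h1 := mem u a hu
    have h2 := mem v b hv
    have := a.val_lt
    have := b.val_lt
    have := u.isLt
    have := v.isLt
    have : u.val ≠ v.val := fun h => huv (Fin.ext h)
    omega
  · rintro ⟨hy, h | ⟨hz', h⟩⟩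
    · have hx : x < 36 := by omega
      exact ⟨_, _, _, _, row hx hy h, by rw [← val hx]; simp, by rw [← val hy]; simp⟩
    · exact ⟨_, _, _, _, row hy hz' h, by rw [← val hy]; simp, by rw [← val hz']; simp⟩

theorem Model.twoRows {b t : Finset (Pt (Fin 3))} (hb : Model b) (ht : t.card = 3) (htb : t ⊆ b) :
    TwoRows t := by
  obtain ⟨x, y, z, hxy, hyz, hz, rfl⟩ := exists_ofNum_of_card_eq_three ht
  have := hb.card_and_sumCheck.2 x y z hxy hyz hz htb
  simp only [sumCheck, Bool.and_eq_true] at this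
  exact (twoRows_iff_spread hxy hyz hz).2 this.1.2

/-- Two 4-element sets through the same three points coincide if their fourth points do, and an
injective numbering recognizes the fourth point from the sum of the four numbers. -/
theorem eq_of_subset_of_sum_eq {P : Type*} [DecidableEq P] {f : P → ℕ} (hf : Function.Injective f)
    {t b b' : Finset P} (ht : t.card = 3) (hb : b.card = 4) (hb' : b'.card = 4) (htb : t ⊆ b)
    (htb' : t ⊆ b') (h : ∑ q ∈ b, f q = ∑ q ∈ b', f q) : b = b' := by
  have aux : ∀ {c : Finset P}, c.card = 4 → t ⊆ c → ∃ w ∉ t, insert w t = c := by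
    intro c hc htc
    have : (c \ t).card = 1 := by rw [Finset.card_sdiff_of_subset htc]; omega
    obtain ⟨w, hw⟩ := Finset.card_eq_one.1 this
    have hw' : w ∈ c \ t := by rw [hw]; simp
    refine ⟨w, (Finset.mem_sdiff.1 hw').2, ?_⟩
    rw [Finset.insert_eq, ← hw, Finset.sdiff_union_of_subset htc]
  obtain ⟨w, hw, rfl⟩ := aux hb htb
  obtain ⟨w', hw', rfl⟩ := aux hb' htb'
  rw [Finset.sum_insert hw, Finset.sum_insert hw', Nat.add_right_cancel_iff] at h
  rw [hf h]

/-- In the three-row system, three points that meet at least two rows lie in a unique block. -/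
theorem model_existsUnique {t : Finset (Pt (Fin 3))} (ht : t.card = 3) (h2 : TwoRows t) :
    ∃! b, Model b ∧ t ⊆ b := by
  obtain ⟨x, y, z, hxy, hyz, hz, rfl⟩ := exists_ofNum_of_card_eq_three ht
  obtain ⟨hv, hx', hy', hz'⟩ := cover_of_spread hxy hyz hz
    ((twoRows_iff_spread hxy hyz hz).1 h2)
  have hb0 := model_blockOf hv
  have hsub : {ofNum x, ofNum y, ofNum z} ⊆ blockOf (codeOf x y z) := by
    intro q hq
    simp only [Finset.mem_insert, Finset.mem_singleton] at hq
    rw [blockOf, List.mem_toFinset]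
    rcases hq with rfl | rfl | rfl
    · exact List.mem_map_of_mem hx'
    · exact List.mem_map_of_mem hy'
    · exact List.mem_map_of_mem hz'
  refine ⟨_, ⟨hb0, hsub⟩, ?_⟩
  rintro b ⟨hb, htb⟩
  have h1 := hb.card_and_sumCheck.2 x y z hxy hyz hz htb
  have h2 := hb0.card_and_sumCheck.2 x y z hxy hyz hz hsub
  simp only [sumCheck, Bool.and_eq_true, Nat.beq_eq] at h1 h2
  exact eq_of_subset_of_sum_eq toNum_injective ht hb.card hb0.card htb hsub (h1.2.symm.trans h2.2)

/-! ### The system on 14 points -/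

/-- The word `w` contains the point with number `x`. -/
def hasPoint (w : List (Fin 14)) (x : ℕ) : Bool := w.any fun q => Nat.beq q.val x

/-- Any three points lie in exactly one word of `words14`. -/
def check14 : Bool :=
  (List.range 14).all fun z => (List.range z).all fun y => (List.range y).all fun x =>
    Nat.beq (words14.countP fun w => hasPoint w x && hasPoint w y && hasPoint w z) 1

theorem check14_eq : check14 = true := by decide +kernel

theorem card_of_mem_blocks14 {b : Finset (Fin 14)} (hb : b ∈ blocks14) : b.card = 4 := by
  obtain ⟨w, hw, rfl⟩ := hb
  have : ∀ w ∈ words14, w.toFinset.card = 4 := by decide +kernel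
  exact this w hw

theorem hasPoint_iff {w : List (Fin 14)} {q : Fin 14} : hasPoint w q.val = true ↔ q ∈ w := by
  simp only [hasPoint, List.any_eq_true, Nat.beq_eq]
  exact ⟨fun ⟨r, hr, h⟩ => Fin.ext h ▸ hr, fun h => ⟨q, h, rfl⟩⟩

theorem blocks14_existsUnique {t : Finset (Fin 14)} (ht : t.card = 3) :
    ∃! b, b ∈ blocks14 ∧ t ⊆ b := by
  have hc : (t.image Fin.val).card = 3 := by
    rw [Finset.card_image_of_injective _ Fin.val_injective, ht]
  obtain ⟨x, y, z, hxy, hyz, h⟩ := exists_lt_lt_of_card_eq_three hc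
  have mem : ∀ {n}, n ∈ t.image Fin.val ↔ ∃ q ∈ t, q.val = n := by simp
  obtain ⟨qx, hqx, rfl⟩ := mem.1 (show x ∈ t.image Fin.val by rw [h]; simp)
  obtain ⟨qy, hqy, rfl⟩ := mem.1 (show y ∈ t.image Fin.val by rw [h]; simp)
  obtain ⟨qz, hqz, rfl⟩ := mem.1 (show z ∈ t.image Fin.val by rw [h]; simp)
  have htq : t = {qx, qy, qz} := by
    apply Finset.image_injective Fin.val_injective
    rw [h]; simp [Finset.image_insert]
  have hc := check14_eq
  rw [check14, List.all_eq_true] at hc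
  have hc := hc _ (List.mem_range.2 qz.isLt)
  rw [List.all_eq_true] at hc
  have hc := hc _ (List.mem_range.2 hyz)
  rw [List.all_eq_true] at hc
  have hc := Nat.eq_of_beq_eq_true (hc _ (List.mem_range.2 hxy))
  rw [List.countP_eq_length_filter, List.length_eq_one_iff] at hc
  obtain ⟨w, hw⟩ := hc
  have key : ∀ v, v = w ↔ v ∈ words14 ∧ t ⊆ v.toFinset := by
    intro v
    rw [← List.mem_singleton, ← hw, List.mem_filter, htq]
    simp [hasPoint_iff, Finset.insert_subset_iff, and_assoc]
  refine ⟨w.toFinset, ⟨⟨w, ((key w).1 rfl).1, rfl⟩, ((key w).1 rfl).2⟩, ?_⟩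
  rintro b ⟨⟨v, hv, rfl⟩, hb⟩
  rw [(key v).2 ⟨hv, hb⟩]

/-! ### Transport of blocks along maps of rows -/

/-- The map of points induced by a map of rows. -/
def mapPt {α β : Type*} (f : α → β) : Pt α → Pt β := Sum.map (Prod.map f id) id

@[simp] theorem mapPt_pt {α β : Type*} (f : α → β) (u : α) (j : ZMod 12) :
    mapPt f (pt u j) = pt (f u) j := rfl

@[simp] theorem mapPt_ptA {α β : Type*} (f : α → β) (h : Fin 2) :
    mapPt f (ptA h) = ptA h := rfl

theorem mapPt_injective {α β : Type*} {f : α → β} (hf : Function.Injective f) :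
    Function.Injective (mapPt f) :=
  Function.Injective.sumMap (hf.prodMap Function.injective_id) Function.injective_id

section Map

set_option linter.unusedSectionVars false

variable {α β : Type*} [DecidableEq α] [DecidableEq β] (f : α → β)

theorem TripleBlock.image {r : Fin 3 → α} {b : Finset (Pt α)} (h : TripleBlock r b) :
    TripleBlock (f ∘ r) (b.image (mapPt f)) := by
  cases h with
  | type2 h b₁ b₂ b₃ hb =>
    simpa [Finset.image_insert] using TripleBlock.type2 (r := f ∘ r) h b₁ b₂ b₃ hb
  | type3 i b₁ b₂ b₃ hb =>
    simpa [Finset.image_insert] using TripleBlock.type3 (r := f ∘ r) i b₁ b₂ b₃ hb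
  | type4 i j ε => simpa [Finset.image_insert] using TripleBlock.type4 (r := f ∘ r) i j ε
  | type5 i j ε => simpa [Finset.image_insert] using TripleBlock.type5 (r := f ∘ r) i j ε
  | type6 i j ε => simpa [Finset.image_insert] using TripleBlock.type6 (r := f ∘ r) i j ε
  | type7 i j ε => simpa [Finset.image_insert] using TripleBlock.type7 (r := f ∘ r) i j ε

theorem TripleBlock.exists_image {r : Fin 3 → α} {b : Finset (Pt β)} (h : TripleBlock (f ∘ r) b) :
    ∃ b₀, TripleBlock r b₀ ∧ b = b₀.image (mapPt f) := by
  cases h with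
  | type2 h b₁ b₂ b₃ hb => exact ⟨_, .type2 h b₁ b₂ b₃ hb, by simp [Finset.image_insert]⟩
  | type3 i b₁ b₂ b₃ hb => exact ⟨_, .type3 i b₁ b₂ b₃ hb, by simp [Finset.image_insert]⟩
  | type4 i j ε => exact ⟨_, .type4 i j ε, by simp [Finset.image_insert]⟩
  | type5 i j ε => exact ⟨_, .type5 i j ε, by simp [Finset.image_insert]⟩
  | type6 i j ε => exact ⟨_, .type6 i j ε, by simp [Finset.image_insert]⟩
  | type7 i j ε => exact ⟨_, .type7 i j ε, by simp [Finset.image_insert]⟩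

theorem PairBlock.image {u v : α} {b : Finset (Pt α)} (h : PairBlock u v b) :
    PairBlock (f u) (f v) (b.image (mapPt f)) := by
  cases h with
  | type8 j ε => simpa [Finset.image_insert] using PairBlock.type8 (u := f u) (v := f v) j ε
  | type9 g ε => simpa [Finset.image_insert] using PairBlock.type9 (u := f u) (v := f v) g ε
  | type10 g ε => simpa [Finset.image_insert] using PairBlock.type10 (u := f u) (v := f v) g ε
  | type11 j e => simpa [Finset.image_insert] using PairBlock.type11 (u := f u) (v := f v) j e
  | type12 j e => simpa [Finset.image_insert] using PairBlock.type12 (u := f u) (v := f v) j e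
  | type13 j e => simpa [Finset.image_insert] using PairBlock.type13 (u := f u) (v := f v) j e
  | type14 δ a a' => simpa [Finset.image_insert] using PairBlock.type14 (u := f u) (v := f v) δ a a'

theorem PairBlock.exists_image {u v : α} {b : Finset (Pt β)} (h : PairBlock (f u) (f v) b) :
    ∃ b₀, PairBlock u v b₀ ∧ b = b₀.image (mapPt f) := by
  cases h with
  | type8 j ε => exact ⟨_, .type8 j ε, by simp [Finset.image_insert]⟩
  | type9 g ε => exact ⟨_, .type9 g ε, by simp [Finset.image_insert]⟩
  | type10 g ε => exact ⟨_, .type10 g ε, by simp [Finset.image_insert]⟩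
  | type11 j e => exact ⟨_, .type11 j e, by simp [Finset.image_insert]⟩
  | type12 j e => exact ⟨_, .type12 j e, by simp [Finset.image_insert]⟩
  | type13 j e => exact ⟨_, .type13 j e, by simp [Finset.image_insert]⟩
  | type14 δ a a' => exact ⟨_, .type14 δ a a', by simp [Finset.image_insert]⟩

theorem TripleBlock.mem_range {r : Fin 3 → α} {b : Finset (Pt α)} (h : TripleBlock r b) {u : α}
    {j : ZMod 12} (hu : pt u j ∈ b) : u ∈ Set.range r := by
  obtain ⟨b₀, -, rfl⟩ := TripleBlock.exists_image (r := id) r h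
  obtain ⟨(⟨i, c⟩ | k), -, hq⟩ := Finset.mem_image.1 hu
  · simp only [mapPt, Sum.map_inl, Prod.map, Sum.inl.injEq, Prod.mk.injEq] at hq
    exact ⟨i, hq.1⟩
  · simp [mapPt] at hq

theorem PairBlock.mem_pair {u v : α} {b : Finset (Pt α)} (h : PairBlock u v b) {w : α}
    {j : ZMod 12} (hw : pt w j ∈ b) : w = u ∨ w = v := by
  cases h <;> simp only [Finset.mem_insert, Finset.mem_singleton, Sum.inl.injEq,
    Prod.mk.injEq] at hw <;> tauto

theorem TwoRows.of_image {t : Finset (Pt α)} (h : TwoRows (t.image (mapPt f))) : TwoRows t := by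
  obtain ⟨u, v, a, b, huv, hu, hv⟩ := h
  have aux : ∀ {u : β} {a : ZMod 12}, pt u a ∈ t.image (mapPt f) → ∃ i, u = f i ∧ pt i a ∈ t := by
    intro u a hu
    obtain ⟨(⟨i, c⟩ | k), hi, hq⟩ := Finset.mem_image.1 hu
    · simp only [mapPt, Sum.map_inl, Prod.map, Sum.inl.injEq, Prod.mk.injEq, id] at hq
      obtain ⟨rfl, rfl⟩ := hq
      exact ⟨i, rfl, hi⟩
    · simp [mapPt] at hq
  obtain ⟨i, rfl, hi⟩ := aux hu
  obtain ⟨k, rfl, hk⟩ := aux hv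
  exact ⟨i, k, a, b, fun h => huv (by rw [h]), hi, hk⟩

theorem TwoRows.image {t : Finset (Pt α)} (h : TwoRows t) (hf : Function.Injective f) :
    TwoRows (t.image (mapPt f)) := by
  obtain ⟨u, v, a, b, huv, hu, hv⟩ := h
  exact ⟨f u, f v, a, b, hf.ne huv, Finset.mem_image.2 ⟨_, hu, rfl⟩,
    Finset.mem_image.2 ⟨_, hv, rfl⟩⟩

end Map

/-! ### Hanani's sixth construction -/

section Sixth

set_option linter.unusedSectionVars false

variable {X : Type*} [Fintype X] [DecidableEq X] {n : ℕ} {𝓑 : Set (Finset X)} {p : X}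
  {T : Set (Fin 3 → {x : X // x ≠ p})} {e : Fin 14 ≃ ZMod 12 ⊕ Fin 2}

theorem IsOrdering.mem (hT : IsOrdering 𝓑 p T) {r : Fin 3 → {x : X // x ≠ p}} (hr : r ∈ T) :
    insert p (Finset.univ.image fun k => (r k : X)) ∈ 𝓑 :=
  (hT.mapsTo hr).1

theorem IsOrdering.injective (hS : IsSQS n 𝓑) (hT : IsOrdering 𝓑 p T)
    {r : Fin 3 → {x : X // x ≠ p}} (hr : r ∈ T) : Function.Injective r := by
  have h4 := hS.2.1 _ (hT.mem hr)
  have h3 : (Finset.univ.image fun k => (r k : X)).card = (Finset.univ : Finset (Fin 3)).card := by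
    have h1 := Finset.card_insert_le p (Finset.univ.image fun k => (r k : X))
    have h2 : (Finset.univ.image fun k => (r k : X)).card ≤ (Finset.univ : Finset (Fin 3)).card :=
      Finset.card_image_le
    simp only [Finset.card_univ, Fintype.card_fin] at *
    omega
  have := Finset.card_image_iff.1 h3
  intro i k hik
  exact this (by simp) (by simp) (congrArg Subtype.val hik)

/-- Two rows occur together in a chosen triple; by `IsOrdering.unique` there is only one. -/
theorem IsOrdering.exists_mem (hS : IsSQS n 𝓑) (hT : IsOrdering 𝓑 p T) {u v : {x : X // x ≠ p}}
    (huv : u ≠ v) : ∃ r ∈ T, u ∈ Set.range r ∧ v ∈ Set.range r := by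
  have hc : ({p, u.1, v.1} : Finset X).card = 3 :=
    Finset.card_eq_three.2 ⟨_, _, _, u.2.symm, v.2.symm, fun h => huv (Subtype.ext h), rfl⟩
  obtain ⟨b, ⟨hb, hsub⟩, -⟩ := hS.2.2 _ hc
  have hpb : p ∈ b := hsub (by simp)
  obtain ⟨r, hr, rfl⟩ := hT.surjOn ⟨hb, hpb⟩
  have aux : ∀ w : {x : X // x ≠ p}, w.1 ∈ ({p, u.1, v.1} : Finset X) → w ∈ Set.range r := by
    intro w hw
    have := hsub hw
    simp only [Finset.mem_insert, w.2, false_or, Finset.mem_image, Finset.mem_univ,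
      true_and] at this
    obtain ⟨k, hk⟩ := this
    exact ⟨k, Subtype.ext hk⟩
  exact ⟨r, hr, aux u (by simp), aux v (by simp)⟩

theorem mem_insert_image_of_mem_range {r : Fin 3 → {x : X // x ≠ p}} {u : {x : X // x ≠ p}}
    (hu : u ∈ Set.range r) : u.1 ∈ insert p (Finset.univ.image fun k => (r k : X)) := by
  obtain ⟨k, rfl⟩ := hu
  exact Finset.mem_insert_of_mem (Finset.mem_image_of_mem _ (Finset.mem_univ k))

theorem IsOrdering.unique (hS : IsSQS n 𝓑) (hT : IsOrdering 𝓑 p T) {u v : {x : X // x ≠ p}}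
    (huv : u ≠ v) {r r' : Fin 3 → {x : X // x ≠ p}} (hr : r ∈ T) (hr' : r' ∈ T)
    (hu : u ∈ Set.range r) (hv : v ∈ Set.range r) (hu' : u ∈ Set.range r')
    (hv' : v ∈ Set.range r') : r = r' := by
  have hc : ({p, u.1, v.1} : Finset X).card = 3 :=
    Finset.card_eq_three.2 ⟨_, _, _, u.2.symm, v.2.symm, fun h => huv (Subtype.ext h), rfl⟩
  refine hT.injOn hr hr' (hS.eq_of_subset hc (hT.mem hr) (hT.mem hr') ?_ ?_)
  · simp only [Finset.insert_subset_iff, Finset.singleton_subset_iff]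
    exact ⟨Finset.mem_insert_self _ _, mem_insert_image_of_mem_range hu,
      mem_insert_image_of_mem_range hv⟩
  · simp only [Finset.insert_subset_iff, Finset.singleton_subset_iff]
    exact ⟨Finset.mem_insert_self _ _, mem_insert_image_of_mem_range hu',
      mem_insert_image_of_mem_range hv'⟩

theorem TripleBlock.exists_model {α : Type*} [DecidableEq α] {r : Fin 3 → α} {b : Finset (Pt α)}
    (h : TripleBlock r b) : ∃ b₀, Model b₀ ∧ b = b₀.image (mapPt r) := by
  obtain ⟨b₀, h₀, rfl⟩ := TripleBlock.exists_image (r := id) r h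
  exact ⟨b₀, Or.inl h₀, rfl⟩

theorem PairBlock.exists_model {α : Type*} [DecidableEq α] {r : Fin 3 → α} {u v : α} (huv : u ≠ v)
    (hu : u ∈ Set.range r) (hv : v ∈ Set.range r) {b : Finset (Pt α)}
    (h : PairBlock u v b) : ∃ b₀, Model b₀ ∧ b = b₀.image (mapPt r) := by
  obtain ⟨i, rfl⟩ := hu
  obtain ⟨k, rfl⟩ := hv
  obtain ⟨b₀, h₀, rfl⟩ := PairBlock.exists_image r h
  exact ⟨b₀, Or.inr ⟨i, k, fun h => huv (by rw [h]), h₀⟩, rfl⟩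

theorem Model.sixthBlock (hS : IsSQS n 𝓑) (hT : IsOrdering 𝓑 p T) {r : Fin 3 → {x : X // x ≠ p}}
    (hr : r ∈ T) {b : Finset (Pt (Fin 3))} (hb : Model b) :
    SixthBlock 𝓑 p T e (b.image (mapPt r)) := by
  rcases hb with h | ⟨u, v, huv, h⟩
  · exact .triple r hr _ (h.image r)
  · exact .pair _ _ ((hT.injective hS hr).ne huv) _ (h.image r)

/-- The points of a block of the last kind: four points in different rows, whose second indices
have sum zero. -/
theorem exists_of_quad (hS : IsSQS n 𝓑) {x y z t : {x : X // x ≠ p}}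
    (hb : ({x.1, y.1, z.1, t.1} : Finset X) ∈ 𝓑) {a₁ a₂ a₃ a₄ : ZMod 12}
    (ha : a₁ + a₂ + a₃ + a₄ = 0) : ∃ g : Finset ({x : X // x ≠ p} × ZMod 12),
      ({pt x a₁, pt y a₂, pt z a₃, pt t a₄} : Finset (Pt _)) = g.image Sum.inl ∧ g.card = 4 ∧
      g.image (fun q => q.1.1) ∈ 𝓑 ∧
      Set.InjOn (fun q => q.1.1) (g : Set ({x : X // x ≠ p} × ZMod 12)) ∧ ∑ q ∈ g, q.2 = 0 := by
  have h4 := hS.2.1 _ hb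
  set g : Finset ({x : X // x ≠ p} × ZMod 12) := {(x, a₁), (y, a₂), (z, a₃), (t, a₄)} with hg
  have him : g.image (fun q => q.1.1) = {x.1, y.1, z.1, t.1} := by
    simp [hg, Finset.image_insert]
  have hle : g.card ≤ 4 := Finset.card_le_four
  have hge : 4 ≤ g.card := by
    rw [← h4, ← him]; exact Finset.card_image_le
  have hinj : Set.InjOn (fun q => q.1.1) (g : Set ({x : X // x ≠ p} × ZMod 12)) := by
    apply Finset.card_image_iff.1
    rw [him, h4]; omega
  refine ⟨g, by simp [hg, Finset.image_insert], by omega, by rw [him]; exact hb, hinj, ?_⟩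
  have hnd : [x.1, y.1, z.1, t.1].Nodup := by
    rw [← Multiset.coe_nodup, ← Multiset.toFinset_card_eq_card_iff_nodup]
    simpa using h4
  simp only [List.nodup_cons, List.mem_cons, List.not_mem_nil, or_false, not_or, ← ne_eq,
    Subtype.coe_ne_coe, List.nodup_nil, not_false_eq_true, and_true] at hnd
  obtain ⟨⟨h12, h13, h14⟩, ⟨h23, h24⟩, h34⟩ := hnd
  rw [hg, Finset.sum_insert (by simp [h12, h13, h14]), Finset.sum_insert (by simp [h23, h24]),
    Finset.sum_insert (by simp [h34]), Finset.sum_singleton]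
  linear_combination ha

/-- The embedding of the points of the SQS(14) into row `i` together with `A0`, `A1`. -/
def copyPt {α : Type*} (e : Fin 14 ≃ ZMod 12 ⊕ Fin 2) (i : α) (q : Fin 14) : Pt α :=
  Sum.map (Prod.mk i) id (e q)

theorem copyPt_injective {α : Type*} (i : α) : Function.Injective (copyPt e i) :=
  (Function.Injective.sumMap (Prod.mk_right_injective i) Function.injective_id).comp e.injective

theorem eq_of_pt_mem_image_copyPt {α : Type*} [DecidableEq α] {i u : α} {a : ZMod 12}
    {b : Finset (Fin 14)} (h : pt u a ∈ b.image (copyPt e i)) : u = i := by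
  obtain ⟨q, -, hq⟩ := Finset.mem_image.1 h
  rw [copyPt] at hq
  rcases he : e q with j | j <;> rw [he] at hq
  · simp only [Sum.map_inl, Sum.inl.injEq, Prod.mk.injEq] at hq
    exact hq.1.symm
  · simp at hq

theorem not_twoRows_image_copyPt {α : Type*} [DecidableEq α] {i : α} {t : Finset (Pt α)}
    {b : Finset (Fin 14)} (h : t ⊆ b.image (copyPt e i)) : ¬ TwoRows t := by
  rintro ⟨u, v, a, c, huv, hu, hv⟩
  exact huv ((eq_of_pt_mem_image_copyPt (h hu)).trans (eq_of_pt_mem_image_copyPt (h hv)).symm)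

theorem exists_copy_of_not_twoRows {α : Type*} [DecidableEq α] {t : Finset (Pt α)}
    (ht : t.card = 3) (h2 : ¬ TwoRows t) :
    ∃ (i : α) (a : ZMod 12) (t₀ : Finset (Fin 14)), pt i a ∈ t ∧ t = t₀.image (copyPt e i) := by
  have hA : ∃ i a, pt i a ∈ t := by
    by_contra! hA
    have hsub : t ⊆ Finset.univ.image (ptA (α := α)) := by
      rintro (⟨i, a⟩ | h) hq
      · exact absurd hq (hA i a)
      · exact Finset.mem_image_of_mem _ (Finset.mem_univ h)
    have h1 := Finset.card_le_card hsub
    have h2 : (Finset.univ.image (ptA (α := α))).card ≤ (Finset.univ : Finset (Fin 2)).card :=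
      Finset.card_image_le
    simp only [Finset.card_univ, Fintype.card_fin] at h2
    omega
  obtain ⟨i, a, hi⟩ := hA
  have hsub : (t : Set (Pt α)) ⊆ copyPt e i '' Set.univ := by
    rintro (⟨k, c⟩ | h) hq
    · have : k = i := by
        by_contra hk
        exact h2 ⟨k, i, c, a, hk, hq, hi⟩
      subst this
      exact ⟨e.symm (Sum.inl c), trivial, by simp [copyPt]⟩
    · exact ⟨e.symm (Sum.inr h), trivial, by simp [copyPt]⟩
  obtain ⟨t₀, -, rfl⟩ := Finset.subset_set_image_iff.1 hsub
  exact ⟨i, a, t₀, hi, rfl⟩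

theorem card_of_sixthBlock (hS : IsSQS n 𝓑) (hT : IsOrdering 𝓑 p T)
    {b : Finset (Pt {x : X // x ≠ p})} (hb : SixthBlock 𝓑 p T e b) : b.card = 4 := by
  cases hb with
  | copy14 i b hb =>
    exact (Finset.card_image_of_injective b (copyPt_injective (e := e) i)).trans
      (card_of_mem_blocks14 hb)
  | triple r hr b hb =>
    obtain ⟨b₀, h₀, rfl⟩ := hb.exists_model
    rw [Finset.card_image_of_injective _ (mapPt_injective (hT.injective hS hr)), h₀.card]
  | pair u v huv b hb =>
    obtain ⟨r, hr, hu, hv⟩ := hT.exists_mem hS huv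
    obtain ⟨b₀, h₀, rfl⟩ := hb.exists_model huv hu hv
    rw [Finset.card_image_of_injective _ (mapPt_injective (hT.injective hS hr)), h₀.card]
  | quad x y z t hb a₁ a₂ a₃ a₄ ha =>
    obtain ⟨g, hg, h4, -⟩ := exists_of_quad hS hb ha
    rw [hg, Finset.card_image_of_injective _ Sum.inl_injective, h4]

/-- Three points of one row together with `A0`, `A1` lie in a unique block, a copy of a block of
the SQS(14). -/
theorem sixth_existsUnique_of_not_twoRows (hS : IsSQS n 𝓑) (hT : IsOrdering 𝓑 p T)
    {t : Finset (Pt {x : X // x ≠ p})} (ht : t.card = 3) (h2 : ¬ TwoRows t) :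
    ∃! b, SixthBlock 𝓑 p T e b ∧ t ⊆ b := by
  obtain ⟨i, a, t₀, hi, rfl⟩ := exists_copy_of_not_twoRows (e := e) ht h2
  rw [Finset.card_image_of_injective _ (copyPt_injective i)] at ht
  obtain ⟨b₀, ⟨hb₀, hsub⟩, huniq⟩ := blocks14_existsUnique ht
  have model : ∀ (r : Fin 3 → {x : X // x ≠ p}) (c : Finset (Pt (Fin 3))),
      Function.Injective r → Model c → ¬ t₀.image (copyPt e i) ⊆ c.image (mapPt r) := by
    intro r c hr hc h
    obtain ⟨t₁, h1, h1'⟩ := Finset.subset_image_iff.1 h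
    rw [← h1'] at h2
    refine h2 ((hc.twoRows ?_ h1).image r hr)
    rw [← Finset.card_image_of_injective t₁ (mapPt_injective hr), h1',
      Finset.card_image_of_injective _ (copyPt_injective i), ht]
  refine ⟨b₀.image (copyPt e i), ⟨.copy14 i b₀ hb₀, Finset.image_subset_image hsub⟩, ?_⟩
  rintro b ⟨hb, htb⟩
  cases hb with
  | copy14 k b hb =>
    obtain rfl : i = k := eq_of_pt_mem_image_copyPt (e := e) (htb hi)
    have := (Finset.image_subset_image_iff (copyPt_injective (e := e) i)).1 htb
    rw [← huniq b ⟨hb, this⟩]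
    rfl
  | triple r hr b hb =>
    obtain ⟨c, hc, rfl⟩ := hb.exists_model
    exact absurd htb (model r c (hT.injective hS hr) hc)
  | pair u v huv b hb =>
    obtain ⟨r, hr, hu, hv⟩ := hT.exists_mem hS huv
    obtain ⟨c, hc, rfl⟩ := hb.exists_model huv hu hv
    exact absurd htb (model r c (hT.injective hS hr) hc)
  | quad x y z s hb a₁ a₂ a₃ a₄ ha =>
    exfalso
    obtain ⟨g, hg, -, -, hinj, -⟩ := exists_of_quad hS hb ha
    rw [hg] at htb
    obtain ⟨g', hg', hgt⟩ := Finset.subset_image_iff.1 htb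
    have hg3 : 1 < g'.card := by
      rw [← Finset.card_image_of_injective g' (Sum.inl_injective (β := Fin 2)), hgt,
        Finset.card_image_of_injective _ (copyPt_injective i), ht]
      omega
    obtain ⟨⟨u, c⟩, hu, ⟨v, d⟩, hv, hne⟩ := Finset.one_lt_card.1 hg3
    refine h2 ⟨u, v, c, d,
      fun huv => hne (hinj (hg' hu) (hg' hv) (congrArg Subtype.val huv)), ?_, ?_⟩
    · rw [← hgt]; exact Finset.mem_image_of_mem _ hu
    · rw [← hgt]; exact Finset.mem_image_of_mem _ hv

/-- Three points of two rows or more of a chosen triple `r`, and possibly `A0`, `A1`, lie in a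
unique block, the image of a block of the three-row model. -/
theorem sixth_existsUnique_of_range (hS : IsSQS n 𝓑) (hT : IsOrdering 𝓑 p T)
    {r : Fin 3 → {x : X // x ≠ p}} (hr : r ∈ T) {t₀ : Finset (Pt (Fin 3))}
    (ht : t₀.card = 3) (h2 : TwoRows t₀) :
    ∃! b, SixthBlock 𝓑 p T e b ∧ t₀.image (mapPt r) ⊆ b := by
  have hri := hT.injective hS hr
  obtain ⟨b₀, ⟨hb₀, hsub⟩, huniq⟩ := model_existsUnique ht h2
  have h2' := h2.image r hri
  have model : ∀ c, Model c → t₀.image (mapPt r) ⊆ c.image (mapPt r) →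
      c.image (mapPt r) = b₀.image (mapPt r) := fun c hc h => by
    rw [huniq c ⟨hc, (Finset.image_subset_image_iff (mapPt_injective hri)).1 h⟩]
  refine ⟨b₀.image (mapPt r), ⟨hb₀.sixthBlock hS hT hr, Finset.image_subset_image hsub⟩, ?_⟩
  rintro b ⟨hb, htb⟩
  have hrow : ∀ {u a}, pt u a ∈ t₀.image (mapPt r) → u ∈ Set.range r := by
    intro u a h
    obtain ⟨(⟨i, c⟩ | k), -, hq⟩ := Finset.mem_image.1 h
    · simp only [mapPt, Sum.map_inl, Prod.map, Sum.inl.injEq, Prod.mk.injEq] at hq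
      exact ⟨i, hq.1⟩
    · simp [mapPt] at hq
  obtain ⟨u, v, a, c, huv, hu, hv⟩ := h2'
  cases hb with
  | copy14 k b hb =>
    exact absurd ⟨u, v, a, c, huv, hu, hv⟩ (not_twoRows_image_copyPt (e := e) htb)
  | triple r' hr' b hb =>
    obtain rfl := hT.unique hS huv hr hr' (hrow hu) (hrow hv) (hb.mem_range (htb hu))
      (hb.mem_range (htb hv))
    obtain ⟨d, hd, rfl⟩ := hb.exists_model
    exact model d hd htb
  | pair u' v' huv' b hb =>
    have hu' := hb.mem_pair (htb hu)
    have hv' := hb.mem_pair (htb hv)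
    have : u' ∈ Set.range r ∧ v' ∈ Set.range r := by
      have h1 := hrow hu
      have h2 := hrow hv
      rcases hu' with rfl | rfl <;> rcases hv' with rfl | rfl
      · exact absurd rfl huv
      · exact ⟨h1, h2⟩
      · exact ⟨h2, h1⟩
      · exact absurd rfl huv
    obtain ⟨d, hd, rfl⟩ := hb.exists_model huv' this.1 this.2
    exact model d hd htb
  | quad x y z s hb a₁ a₂ a₃ a₄ ha =>
    -- the three points would span the block of `𝓑` through `p` that belongs to `r`
    exfalso
    obtain ⟨g, hg, -, hgB, hinj, -⟩ := exists_of_quad hS hb ha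
    rw [hg] at htb
    obtain ⟨g', hg', hgt⟩ := Finset.subset_image_iff.1 htb
    have hg3 : (g'.image fun q => q.1.1).card = 3 := by
      rw [Finset.card_image_of_injOn (hinj.mono hg'),
        ← Finset.card_image_of_injective g' (Sum.inl_injective (β := Fin 2)), hgt,
        Finset.card_image_of_injective _ (mapPt_injective hri), ht]
    have hsub' : (g'.image fun q => q.1.1) ⊆
        insert p (Finset.univ.image fun k => (r k : X)) := by
      intro w hw
      obtain ⟨⟨w, c⟩, hq, rfl⟩ := Finset.mem_image.1 hw
      refine mem_insert_image_of_mem_range (hrow (a := c) ?_)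
      rw [← hgt]; exact Finset.mem_image_of_mem _ hq
    have := hS.eq_of_subset hg3 hgB (hT.mem hr) (Finset.image_subset_image hg') hsub'
    have hp : p ∈ g.image fun q => q.1.1 := by rw [this]; exact Finset.mem_insert_self _ _
    obtain ⟨q, -, hq⟩ := Finset.mem_image.1 hp
    exact q.1.2 hq

/-- Three points in three rows that do not form a block of `𝓑` with `p` lie in a unique block,
whose rows form a block of `𝓑` not through `p`. -/
theorem sixth_existsUnique_of_transversal (hS : IsSQS n 𝓑) (hT : IsOrdering 𝓑 p T)
    {r : Fin 3 → {x : X // x ≠ p}} (hr : r ∈ T) {u v w : {x : X // x ≠ p}} (huv : u ≠ v)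
    (hu : u ∈ Set.range r) (hv : v ∈ Set.range r) (hw : w ∉ Set.range r) (a b c : ZMod 12) :
    ∃! d, SixthBlock 𝓑 p T e d ∧ {pt u a, pt v b, pt w c} ⊆ d := by
  have huw : u ≠ w := fun h => hw (h ▸ hu)
  have hvw : v ≠ w := fun h => hw (h ▸ hv)
  have hc3 : ({u.1, v.1, w.1} : Finset X).card = 3 :=
    Finset.card_eq_three.2 ⟨_, _, _, Subtype.coe_ne_coe.2 huv, Subtype.coe_ne_coe.2 huw,
      Subtype.coe_ne_coe.2 hvw, rfl⟩
  obtain ⟨B, ⟨hB, hsub⟩, hBu⟩ := hS.2.2 _ hc3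
  have hpB : p ∉ B := by
    intro hp
    obtain ⟨r', hr', rfl⟩ := hT.surjOn ⟨hB, hp⟩
    have aux : ∀ x : {x : X // x ≠ p}, x.1 ∈ ({u.1, v.1, w.1} : Finset X) → x ∈ Set.range r' := by
      intro x hx
      have := hsub hx
      simp only [Finset.mem_insert, x.2, false_or, Finset.mem_image, Finset.mem_univ,
        true_and] at this
      obtain ⟨k, hk⟩ := this
      exact ⟨k, Subtype.ext hk⟩
    obtain rfl := hT.unique hS huv hr hr' hu hv (aux u (by simp)) (aux v (by simp))
    exact hw (aux w (by simp))
  have hB4 := hS.2.1 B hB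
  have h1 : (B \ {u.1, v.1, w.1}).card = 1 := by
    rw [Finset.card_sdiff_of_subset hsub]; omega
  obtain ⟨s, hs⟩ := Finset.card_eq_one.1 h1
  have hsB : s ∈ B \ {u.1, v.1, w.1} := by rw [hs]; simp
  rw [Finset.mem_sdiff] at hsB
  have hsp : s ≠ p := fun h => hpB (h ▸ hsB.1)
  have hBs : B = {u.1, v.1, w.1, s} := by
    rw [← Finset.union_sdiff_of_subset hsub, hs]
    ext; simp
  have hquad : ({u.1, v.1, w.1, (⟨s, hsp⟩ : {x : X // x ≠ p}).1} : Finset X) ∈ 𝓑 := hBs ▸ hB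
  refine ⟨_, ⟨.quad u v w ⟨s, hsp⟩ hquad a b c (-(a + b + c)) (by ring), ?_⟩, ?_⟩
  · intro q; simp only [Finset.mem_insert, Finset.mem_singleton]; tauto
  rintro d ⟨hd, htd⟩
  have mu : pt u a ∈ d := htd (by simp)
  have mv : pt v b ∈ d := htd (by simp)
  have mw : pt w c ∈ d := htd (by simp)
  cases hd with
  | copy14 k d hd =>
    exact absurd ⟨u, v, a, b, huv, mu, mv⟩ (not_twoRows_image_copyPt (e := e) subset_rfl)
  | triple r' hr' d hd =>
    obtain rfl := hT.unique hS huv hr hr' hu hv (hd.mem_range mu) (hd.mem_range mv)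
    exact absurd (hd.mem_range mw) hw
  | pair u' v' huv' d hd =>
    exfalso
    rcases hd.mem_pair mu with h1 | h1 <;> rcases hd.mem_pair mv with h2 | h2 <;>
      rcases hd.mem_pair mw with h3 | h3 <;>
      first
      | exact huv (h1.trans h2.symm)
      | exact huw (h1.trans h3.symm)
      | exact hvw (h2.trans h3.symm)
  | quad x y z t hb a₁ a₂ a₃ a₄ ha =>
    obtain ⟨g, hg, hg4, hgB, hinj, hsum⟩ := exists_of_quad hS hb ha
    rw [hg] at htd ⊢
    obtain ⟨g', hg', hgt⟩ := Finset.subset_image_iff.1 htd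
    obtain rfl : g' = {(u, a), (v, b), (w, c)} := by
      apply Finset.image_injective (Sum.inl_injective (β := Fin 2))
      rw [hgt]; simp [Finset.image_insert]
    have hc3' : ({(u, a), (v, b), (w, c)} : Finset ({x : X // x ≠ p} × ZMod 12)).card = 3 :=
      Finset.card_eq_three.2 ⟨(u, a), (v, b), (w, c), fun h => huv (Prod.ext_iff.1 h).1,
        fun h => huw (Prod.ext_iff.1 h).1, fun h => hvw (Prod.ext_iff.1 h).1, rfl⟩
    have h1 : (g \ {(u, a), (v, b), (w, c)}).card = 1 := by
      rw [Finset.card_sdiff_of_subset hg']; omega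
    obtain ⟨q, hq⟩ := Finset.card_eq_one.1 h1
    have hqg : q ∈ g \ {(u, a), (v, b), (w, c)} := by rw [hq]; simp
    rw [Finset.mem_sdiff] at hqg
    have hgq : g = {(u, a), (v, b), (w, c), q} := by
      rw [← Finset.union_sdiff_of_subset hg', hq]
      ext; simp
    have hgB' : g.image (fun q => q.1.1) = B := by
      refine hBu _ ⟨hgB, ?_⟩
      rw [hgq]
      intro x; simp only [Finset.mem_image, Finset.mem_insert, Finset.mem_singleton]
      rintro (rfl | rfl | rfl) <;> simp
    obtain ⟨q₁, q₂⟩ := q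
    have hne : ∀ x k, (x, k) ∈ ({(u, a), (v, b), (w, c)} : Finset ({x : X // x ≠ p} × ZMod 12)) →
        q₁.1 ≠ x.1 := by
      intro x k hx h
      have := hinj (hg' hx) hqg.1 h.symm
      exact hqg.2 (this ▸ hx)
    have hq1 : q₁ = ⟨s, hsp⟩ := by
      have : q₁.1 ∈ B := by
        rw [← hgB']; exact Finset.mem_image_of_mem _ hqg.1
      rw [hBs] at this
      simp only [Finset.mem_insert, Finset.mem_singleton, hne u a (by simp), hne v b (by simp),
        hne w c (by simp), false_or] at this
      exact Subtype.ext this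
    have hq2 : q₂ = -(a + b + c) := by
      rw [hgq, Finset.sum_insert, Finset.sum_insert, Finset.sum_insert,
        Finset.sum_singleton] at hsum
      · simp only at hsum
        linear_combination hsum
      · intro h
        rw [Finset.mem_singleton] at h
        exact hqg.2 (by rw [← h]; simp)
      · intro h
        simp only [Finset.mem_insert, Finset.mem_singleton, Prod.mk.injEq, hvw, false_and,
          false_or] at h
        exact hqg.2 (by rw [← h.1, ← h.2]; simp)
      · intro h
        simp only [Finset.mem_insert, Finset.mem_singleton, Prod.mk.injEq, huv, huw, false_and,
          false_or] at h
        exact hqg.2 (by rw [← h.1, ← h.2]; simp)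
    rw [hgq, hq1, hq2]
    simp [Finset.image_insert]

theorem sixth_isSQS (hS : IsSQS n 𝓑) (hT : IsOrdering 𝓑 p T) :
    IsSQS (12 * n - 10) (sixth 𝓑 p T e) := by
  refine ⟨?_, fun b hb => card_of_sixthBlock hS hT hb, fun t ht => ?_⟩
  · have hn := hS.1
    have hpos : 0 < Fintype.card X := Fintype.card_pos_iff.2 ⟨p⟩
    rw [Fintype.card_sum, Fintype.card_prod, ZMod.card, Fintype.card_fin,
      Fintype.card_subtype_compl, Fintype.card_subtype_eq, hn]
    omega
  by_cases h2 : TwoRows t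
  · obtain ⟨u, v, a, b, huv, hu, hv⟩ := id h2
    obtain ⟨r, hr, hur, hvr⟩ := hT.exists_mem hS huv
    by_cases hsub : (t : Set (Pt {x : X // x ≠ p})) ⊆ mapPt r '' Set.univ
    · obtain ⟨t₀, -, rfl⟩ := Finset.subset_set_image_iff.1 hsub
      rw [Finset.card_image_of_injective _ (mapPt_injective (hT.injective hS hr))] at ht
      exact sixth_existsUnique_of_range hS hT hr ht (TwoRows.of_image r h2)
    · obtain ⟨q, hq, hqr⟩ := Set.not_subset.1 hsub
      rcases q with ⟨w, c⟩ | k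
      · have hw : w ∉ Set.range r := by
          rintro ⟨i, rfl⟩
          exact hqr ⟨pt i c, trivial, rfl⟩
        have htu : t = {pt u a, pt v b, pt w c} := by
          symm
          apply Finset.eq_of_subset_of_card_le
          · simp only [Finset.insert_subset_iff, Finset.singleton_subset_iff]
            exact ⟨hu, hv, hq⟩
          · rw [ht, Finset.card_eq_three.2 ⟨_, _, _, ?_, ?_, ?_, rfl⟩]
            · simp [huv]
            · intro h; simp at h; exact hw (h.1 ▸ hur)
            · intro h; simp at h; exact hw (h.1 ▸ hvr)
        rw [htu]
        exact sixth_existsUnique_of_transversal hS hT hr huv hur hvr hw a b c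
      · exact absurd ⟨ptA k, trivial, rfl⟩ hqr
  · exact sixth_existsUnique_of_not_twoRows hS hT ht h2

end Sixth

end Hanani

/-! ### Isomorphic copies and choices of orders -/

section Transport

variable {X Y : Type*} [Fintype X] [Fintype Y] {n : ℕ} {𝓑 : Set (Finset X)}

theorem IsSQS.map_equiv (hS : IsSQS n 𝓑) (φ : X ≃ Y) :
    IsSQS n (Finset.map φ.toEmbedding '' 𝓑) := by
  refine ⟨(Fintype.card_congr φ).symm.trans hS.1, ?_, fun t ht => ?_⟩
  · rintro _ ⟨b, hb, rfl⟩
    rw [Finset.card_map, hS.2.1 b hb]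
  · obtain ⟨t, rfl⟩ : ∃ t', t = Finset.map φ.toEmbedding t' :=
      ⟨t.map φ.symm.toEmbedding, by rw [Finset.map_map]; simp⟩
    rw [Finset.card_map] at ht
    obtain ⟨b, ⟨hb, hsub⟩, huniq⟩ := hS.2.2 t ht
    refine ⟨b.map φ.toEmbedding, ⟨⟨b, hb, rfl⟩, Finset.map_subset_map.2 hsub⟩, ?_⟩
    rintro _ ⟨⟨b', hb', rfl⟩, hsub'⟩
    rw [huniq b' ⟨hb', Finset.map_subset_map.1 hsub'⟩]

theorem Hanani.exists_isOrdering [DecidableEq X] (hS : IsSQS n 𝓑) (p : X) :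
    ∃ T, Hanani.IsOrdering 𝓑 p T := by
  have h : ∀ b : {b // b ∈ 𝓑 ∧ p ∈ b}, ∃ r : Fin 3 → {x : X // x ≠ p},
      insert p (Finset.univ.image fun k => (r k : X)) = b.1 := by
    rintro ⟨b, hb, hpb⟩
    have h3 : (b.erase p).card = 3 := by rw [Finset.card_erase_of_mem hpb, hS.2.1 b hb]
    obtain ⟨x, y, z, -, -, -, hxyz⟩ := Finset.card_eq_three.1 h3
    have hne : ∀ w ∈ b.erase p, w ≠ p := fun w hw => Finset.ne_of_mem_erase hw
    refine ⟨![⟨x, hne x (by rw [hxyz]; simp)⟩, ⟨y, hne y (by rw [hxyz]; simp)⟩,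
      ⟨z, hne z (by rw [hxyz]; simp)⟩], ?_⟩
    have : (Finset.univ.image fun k => ((![⟨x, hne x (by rw [hxyz]; simp)⟩,
        ⟨y, hne y (by rw [hxyz]; simp)⟩, ⟨z, hne z (by rw [hxyz]; simp)⟩] :
        Fin 3 → {x : X // x ≠ p}) k : X)) = {x, y, z} := by
      ext w; simp [Fin.exists_fin_succ, eq_comm]
    rw [this, ← hxyz, Finset.insert_erase hpb]
  choose r hr using h
  refine ⟨Set.range r, ?_, ?_, ?_⟩
  · rintro _ ⟨b, rfl⟩
    dsimp only
    rw [hr]; exact b.2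
  · rintro _ ⟨b, rfl⟩ _ ⟨b', rfl⟩ h
    dsimp only at h
    rw [hr, hr] at h
    rw [Subtype.ext h]
  · intro b hb
    exact ⟨_, ⟨⟨b, hb⟩, rfl⟩, hr _⟩

end Transport

theorem mainTheorem7 {X : Type*} [Fintype X] [DecidableEq X] (n : ℕ) (𝓑 : Set (Finset X))
    (hS : IsSQS n 𝓑) (hO : AdmitsOneOcycle 𝓑) :
    (∃ 𝓒 : Set (Finset (Fin (12 * n - 10))), IsSQS (12 * n - 10) 𝓒 ∧ AdmitsOneOcycle 𝓒) ∧
    ∀ (p : X) (T : Set (Fin 3 → {x : X // x ≠ p})) (e : Fin 14 ≃ ZMod 12 ⊕ Fin 2),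
      Hanani.IsOrdering 𝓑 p T →
        IsSQS (12 * n - 10) (Hanani.sixth 𝓑 p T e) ∧
          AdmitsOneOcycle (Hanani.sixth 𝓑 p T e) := by
  -- a system with a 1-ocycle has a block, hence at least four points
  have hb : ∃ b, b ∈ 𝓑 := by
    obtain ⟨m, w, -, -, hbij, -⟩ := hO
    exact ⟨_, hbij.mapsTo (Set.mem_univ 0)⟩
  obtain ⟨b, hb⟩ := hb
  have h4 := hS.2.1 b hb
  have hn : 4 ≤ n := by
    rw [← h4, ← hS.1]; exact Finset.card_le_univ b
  have hn' : 10 ≤ 12 * n - 10 := by omega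
  have key : ∀ (p : X) (T : Set (Fin 3 → {x : X // x ≠ p})) (e : Fin 14 ≃ ZMod 12 ⊕ Fin 2),
      Hanani.IsOrdering 𝓑 p T → IsSQS (12 * n - 10) (Hanani.sixth 𝓑 p T e) :=
    fun p T e hT => Hanani.sixth_isSQS hS hT
  refine ⟨?_, fun p T e hT => ⟨key p T e hT, (key p T e hT).admitsOneOcycle hn'⟩⟩
  obtain ⟨p, -⟩ := Finset.card_pos.1 (by omega : 0 < b.card)
  obtain ⟨T, hT⟩ := Hanani.exists_isOrdering hS p
  have e : Fin 14 ≃ ZMod 12 ⊕ Fin 2 :=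
    Fintype.equivOfCardEq (by rw [Fintype.card_sum, ZMod.card, Fintype.card_fin, Fintype.card_fin])
  have h := key p T e hT
  have φ := Fintype.equivFinOfCardEq h.1
  exact ⟨_, h.map_equiv φ, (h.map_equiv φ).admitsOneOcycle hn'⟩
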